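/- Let $\theta,\kappa$ be cardinals with $\omega \le \theta < \kappa$, and let $H$ be a centreless group of cardinality $\theta$. For a centreless group $G$ the automorphism tower $G=G_0 \trianglelefteq G_1 \trianglelefteq \dots \trianglelefteq G_\alpha \trianglelefteq G_{\alpha+1}\trianglelefteq\dots$ is the chain indexed by the ordinals such that $G_{\alpha+1}=\operatorname{Aut} G_\alpha$ (where $G_\alpha$ is identified with $\operatorname{Inn} G_\alpha$ via $g \mapsto (x\mapsto gxg^{-1})$) and $G_\alpha=\bigcup_{\beta<\alpha}G_\beta$ for limit ordinals $\alpha$; its height $\tau(G)$ is the least ordinal $\alpha$ with $G_{\alpha+1}=G_\alpha$. (By convention $\tau(G)=\infty$, larger than every ordinal, if there is no such $\alpha$; by a theorem of Thomas this never happens.) Let $\operatorname{Sym}(\kappa)$ be the group of all permutations of a set of cardinality $\kappa$ and $\operatorname{Alt}(\kappa)$ its subgroup of products of an even number of transpositions. Suppose that $\tau(H)\ge 1$, and put $G = H\times \operatorname{Alt}(\kappa)$. Then $\tau(G)=\tau(H)$. Moreover $G_\beta = H_\beta\times\operatorname{Sym}(\kappa)$ for every ordinal $\beta\ge 1$, in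 the following sense: there are isomorphisms $e_\beta : G_\beta \to H_\beta\times \operatorname{Sym}(\kappa)$, for all $\beta\ge 1$, which restrict to the inclusion $H\times\operatorname{Alt}(\kappa)\hookrightarrow H_\beta\times\operatorname{Sym}(\kappa)$ on $G=G_0$, and such that for $1\le\beta\le\gamma$ the restriction of $e_\gamma$ to $G_\beta$ is $e_\beta$ followed by the inclusion $H_\beta\times \operatorname{Sym}(\kappa)\hookrightarrow H_\gamma\times \operatorname{Sym}(\kappa)$. -/

import Mathlib

open CategoryTheory CategoryTheory.Limits CategoryTheory.SmallObject Cardinal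

universe u

/-- Directed colimits of groups indexed by ordinals exist. -/
theorem hasColimitsOfShape_grpCat (J : Type u) [LinearOrder J] [Nonempty J] :
    HasColimitsOfShape J GrpCat.{u} where
  has_colimit F := HasColimit.mk
    ⟨GrpCat.FilteredColimits.colimitCocone.{u, u} F,
      GrpCat.FilteredColimits.colimitCoconeIsColimit.{u, u} F⟩

instance hasIterationOfShape_ordinal : HasIterationOfShape Ordinal.{u} GrpCat.{u + 1} where
  hasColimitsOfShape_of_isSuccLimit j hj := by
    have : Nonempty (Set.Iio j) := hj.nonempty_Iio.to_subtype
    exact hasColimitsOfShape_grpCat (Set.Iio j)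
  hasColimitsOfShape := hasColimitsOfShape_grpCat Ordinal.{u}

/-- One step of the automorphism tower: a group `X` is sent to `Aut X`, with the natural map
`X → Aut X` taking `g` to the inner automorphism `x ↦ g * x * g⁻¹`. The starting group is `G`. -/
def autSuccStruct (G : GrpCat.{u}) : SuccStruct GrpCat.{u} where
  X₀ := G
  succ X := GrpCat.of (MulAut X)
  toSucc _ := GrpCat.ofHom MulAut.conj

/-- The automorphism tower of `G`, as a functor from the well-ordered class of ordinals to groups.
It is the transfinite iteration of `X ↦ Aut X` along the natural maps `X → Aut X`, starting at `G`,
and with direct limits taken at limit ordinals (for centreless `G` all the maps are injective and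
these direct limits are unions). The copy `ULift G` of `G` is used since the tower is indexed by
all ordinals of the universe of `G`, which form a type in the next universe. -/
noncomputable def autTower (G : Type u) [Group G] : Ordinal.{u} ⥤ GrpCat.{u + 1} :=
  (autSuccStruct (GrpCat.of (ULift.{u + 1} G))).iterationFunctor Ordinal.{u}

/-- The `β`-th group `G_β` of the automorphism tower of `G`. -/
abbrev AutTowerGroup (G : Type u) [Group G] (β : Ordinal.{u}) : Type (u + 1) :=
  (autTower G).obj β

/-- The inclusion `G_β → G_γ` of the automorphism tower, for `β ≤ γ`. -/
noncomputable def autTowerMap (G : Type u) [Group G] {β γ : Ordinal.{u}} (h : β ≤ γ) :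
    AutTowerGroup G β →* AutTowerGroup G γ :=
  ((autTower G).map (homOfLE h)).hom

/-- The inclusion `G = G_0 → G_β` of the automorphism tower. -/
noncomputable def autTowerIncl (G : Type u) [Group G] (β : Ordinal.{u}) :
    G →* AutTowerGroup G β :=
  (((autSuccStruct (GrpCat.of (ULift.{u + 1} G))).ιIterationFunctor Ordinal.{u}).app β).hom.comp
    (MulEquiv.ulift.{u, u + 1} (α := G)).symm.toMonoidHom

/-- `G_{α + 1} = G_α`, that is, the inclusion of `G_α` into `G_{α + 1}` is onto. -/
def AutTowerStableAt (G : Type u) [Group G] (α : Ordinal.{u}) : Prop :=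
  Function.Surjective (autTowerMap G (Order.le_succ α))

open Classical in
/-- The height `τ(G)` of the automorphism tower of a centreless group `G`: the least ordinal `α`
such that `G_{α + 1} = G_α`. The value `⊤` stands for a tower that never terminates. -/
noncomputable def autTowerHeight (G : Type u) [Group G] : WithTop Ordinal.{u} :=
  if ∃ α, AutTowerStableAt G α then ((sInf {α | AutTowerStableAt G α} : Ordinal.{u}) :
    WithTop Ordinal.{u}) else ⊤

open Classical in
/-- The alternating group on a possibly infinite set `Ω`: the group of all permutations of `Ω`
that are products of an even number of transpositions. -/
def altGroup (Ω : Type u) : Subgroup (Equiv.Perm Ω) where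
  carrier := {σ | ∃ l : List (Equiv.Perm Ω), (∀ g ∈ l, g.IsSwap) ∧ Even l.length ∧ l.prod = σ}
  one_mem' := ⟨[], by simp, by simp, rfl⟩
  mul_mem' := by
    rintro _ _ ⟨l, hl, he, rfl⟩ ⟨l', hl', he', rfl⟩
    refine ⟨l ++ l', ?_, ?_, List.prod_append⟩
    · intro g hg
      rcases List.mem_append.1 hg with h | h
      exacts [hl g h, hl' g h]
    · rw [List.length_append]
      exact he.add he'
  inv_mem' := by
    rintro _ ⟨l, hl, he, rfl⟩
    refine ⟨(l.map fun x => x⁻¹).reverse, ?_, by simpa using he, (List.prod_inv_reverse l).symm⟩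
    intro g hg
    obtain ⟨x, hx, rfl⟩ := List.mem_map.1 (List.mem_reverse.1 hg)
    obtain ⟨a, b, hab, rfl⟩ := hl x hx
    exact ⟨a, b, hab, Equiv.swap_inv a b⟩

/-- The zeroth group of the tower is `G`. -/
theorem autTowerIncl_zero_bijective (G : Type u) [Group G] :
    Function.Bijective (autTowerIncl G 0) := by
  let Φ := autSuccStruct (GrpCat.of (ULift.{u + 1} G))
  have h : (Φ.ιIterationFunctor Ordinal.{u}).app 0 =
      (Φ.iterationFunctorObjBotIso Ordinal.{u}).inv := by
    change (Φ.iterationFunctorObjBotIso Ordinal.{u}).inv ≫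
      (Φ.iterationFunctor Ordinal.{u}).map (𝟙 _) = _
    rw [CategoryTheory.Functor.map_id]
    exact Category.comp_id _
  have h2 : Function.Bijective ((Φ.ιIterationFunctor Ordinal.{u}).app 0).hom := by
    rw [h]
    exact ((forget GrpCat).mapIso (Φ.iterationFunctorObjBotIso Ordinal.{u}).symm).toEquiv.bijective
  exact h2.comp (MulEquiv.ulift.{u, u + 1} (α := G)).symm.bijective

theorem autTowerMap_trans (G : Type u) [Group G] {α β γ : Ordinal.{u}} (h : α ≤ β) (h' : β ≤ γ)
    (x : AutTowerGroup G α) :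
    autTowerMap G h' (autTowerMap G h x) = autTowerMap G (h.trans h') x := by
  have := (autTower G).map_comp (homOfLE h) (homOfLE h')
  exact (congrArg (fun f => f.hom x) this).symm

theorem autTowerMap_self (G : Type u) [Group G] (β : Ordinal.{u}) (x : AutTowerGroup G β) :
    autTowerMap G (le_refl β) x = x :=
  congrArg (fun f => f.hom x) ((autTower G).map_id β)

theorem autTowerMap_incl (G : Type u) [Group G] {β γ : Ordinal.{u}} (h : β ≤ γ) (g : G) :
    autTowerMap G h (autTowerIncl G β g) = autTowerIncl G γ g :=
  autTowerMap_trans G bot_le h _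

/-- The successor stage: `G_{β + 1}` is `Aut G_β`, and the inclusion of `G_β` is the natural
map. -/
theorem autTower_succ (G : Type u) [Group G] (β : Ordinal.{u}) :
    ∃ φ : AutTowerGroup G (Order.succ β) ≃* MulAut (AutTowerGroup G β),
      ∀ g, φ (autTowerMap G (Order.le_succ β) g) = MulAut.conj g := by
  let Φ := autSuccStruct (GrpCat.of (ULift.{u + 1} G))
  let i := Φ.iterationFunctorObjSuccIso β (not_isMax β)
  refine ⟨i.groupIsoToMulEquiv, fun g => ?_⟩
  have h : (Φ.iterationFunctor Ordinal.{u}).map (homOfLE (Order.le_succ β)) ≫ i.hom =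
      Φ.toSucc _ := by
    rw [Φ.iterationFunctor_map_succ β (not_isMax β), Category.assoc]
    change _ ≫ i.inv ≫ i.hom = _
    rw [i.inv_hom_id, Category.comp_id]
  exact congrArg (fun f => f.hom g) h

theorem exists_isColimit_autTower (G : Type u) [Group G] (δ : Ordinal.{u})
    (hδ : Order.IsSuccLimit δ) :
    Nonempty (IsColimit (((forget GrpCat.{u + 1}).mapCocone
      ((Set.principalSegIio δ).cocone (autTower G))))) := by
  have : Nonempty (Set.Iio δ) := hδ.nonempty_Iio.to_subtype
  let Φ := autSuccStruct (GrpCat.of (ULift.{u + 1} G))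
  exact ⟨isColimitOfPreserves (forget GrpCat.{u + 1})
    ((Φ.iterationFunctor Ordinal.{u}).isColimitOfIsWellOrderContinuous δ hδ)⟩

/-- The limit stage: `G_δ` is the union of the images of the `G_β` with `β < δ`. -/
theorem autTower_limit (G : Type u) [Group G] (δ : Ordinal.{u}) (hδ : Order.IsSuccLimit δ)
    (x : AutTowerGroup G δ) : ∃ (β : Ordinal.{u}) (h : β < δ) (y : AutTowerGroup G β),
      autTowerMap G h.le y = x := by
  obtain ⟨hc⟩ := exists_isColimit_autTower G δ hδ
  obtain ⟨⟨β, h⟩, y, hy⟩ := Types.jointly_surjective _ hc x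
  exact ⟨β, h, y, hy⟩

/-- Elements of `G_β` with the same image at a limit stage are identified at an earlier stage. -/
theorem autTower_limit_eq (G : Type u) [Group G] (δ : Ordinal.{u}) (hδ : Order.IsSuccLimit δ)
    {β : Ordinal.{u}} (hβ : β < δ) (x y : AutTowerGroup G β)
    (hxy : autTowerMap G hβ.le x = autTowerMap G hβ.le y) :
    ∃ (γ : Ordinal.{u}) (_ : γ < δ) (h' : β ≤ γ), autTowerMap G h' x = autTowerMap G h' y := by
  have : Nonempty (Set.Iio δ) := hδ.nonempty_Iio.to_subtype
  obtain ⟨hc⟩ := exists_isColimit_autTower G δ hδ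
  obtain ⟨⟨γ, hγ⟩, f, h⟩ := (Types.FilteredColimit.isColimit_eq_iff' hc
    (i := ⟨β, hβ⟩) x y).1 hxy
  exact ⟨γ, hγ, leOfHom f, h⟩

/-! The two factors of `H × Alt(Ω)` cannot interact, because `Alt(Ω)` is too large to be a normal
subgroup of any `H_β`.

Let `K` be centreless and let `S` be normal in `Sym(Ω)` with `Alt(Ω) ≤ S`. Since `Alt(Ω)` is simple,
an automorphism of `K × S` either maps it into itself or moves it to a normal subgroup meeting it
trivially. In the latter case the two subgroups commute, and as `Alt(Ω)` has trivial centralizer in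
`Sym(Ω)`, its image is a normal subgroup of `K`. If `K` has no such subgroup, then `Aut (K × S) =
Aut K × Sym(Ω)`, because all automorphisms of `Alt(Ω)` come from `Sym(Ω)`
(`exists_conj_of_mulAut_altGroup`, `prodMulAut_bijective`). For `K = H_β` this is the successor step
of the tower; limit stages are unions.

The exclusion is `not_normal_range_of_card_lt`. Suppose `Alt(Ω)` is normal in `H_β`. The even
permutations lying in `H` itself move at most `|H|` points altogether. Passing from `H_γ` to
`H_{γ+1}`, the part of a new even permutation outside the points already moved commutes with the
action of `H`. Even permutations commuting with that action are trivial, since `H` has trivial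
centralizer in `H_β`, so at most two finitary ones exist, and they move finitely many points. Thus
all even permutations live on a set of size at most `|H| < |Ω|`, which is absurd. -/

/-! ### Trivial centralizers and injectivity in the automorphism tower -/

theorem ordinal_limit_induction {p : Ordinal.{u} → Prop} (zero : p 0)
    (succ : ∀ β, p β → p (Order.succ β))
    (limit : ∀ δ, Order.IsSuccLimit δ → (∀ β < δ, p β) → p δ) (β : Ordinal.{u}) : p β := by
  induction β using Ordinal.limitRecOn with
  | zero => exact zero
  | add_one β ih => simpa using succ β ih
  | limit δ hδ ih => exact limit δ hδ ih

/-- Conjugating the inner automorphism of `z` by the automorphism `y` gives the inner automorphism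
of `y(z)`; hence `G_γ` is normal in `G_{γ+1}`. -/
theorem autTower_conj (G : Type u) [Group G] (γ : Ordinal.{u})
    (y : AutTowerGroup G (Order.succ γ)) (z : AutTowerGroup G γ) :
    ∃ z', y * autTowerMap G (Order.le_succ γ) z * y⁻¹ = autTowerMap G (Order.le_succ γ) z' := by
  obtain ⟨φ, hφ⟩ := autTower_succ G γ
  refine ⟨φ y z, φ.injective ?_⟩
  rw [map_mul, map_mul, map_inv, hφ, hφ]
  ext w
  simp

/-- Homomorphisms out of a stage of the tower are determined by their values on `G`, provided that
the image of `G` has trivial centralizer. -/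
theorem autTower_hom_ext (G : Type u) [Group G] {L : Type*} [Group L] {β : Ordinal.{u}}
    {f g : AutTowerGroup G β →* L}
    (hfg : ∀ x, f (autTowerIncl G β x) = g (autTowerIncl G β x))
    (hc : ∀ z : L, (∀ x, Commute z (f (autTowerIncl G β x))) → z = 1) : f = g := by
  have key : ∀ γ : Ordinal.{u}, ∀ (h : γ ≤ β) (y : AutTowerGroup G γ),
      f (autTowerMap G h y) = g (autTowerMap G h y) := by
    intro γ
    induction γ using ordinal_limit_induction with
    | zero =>
      intro h y
      obtain ⟨x, rfl⟩ := (autTowerIncl_zero_bijective G).2 y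
      rw [autTowerMap_incl, hfg]
    | succ γ ih =>
      intro h y
      have hγ : γ ≤ β := (Order.le_succ γ).trans h
      -- Since `y` normalizes `G_γ`, where `f` and `g` agree, `f y` and `g y` conjugate the image of
      -- `G_γ` in the same way. Their quotient then centralizes the image of `G`.
      have h1 : ∀ z : AutTowerGroup G γ,
          f (autTowerMap G h y) * f (autTowerMap G hγ z) * (f (autTowerMap G h y))⁻¹ =
          g (autTowerMap G h y) * f (autTowerMap G hγ z) * (g (autTowerMap G h y))⁻¹ := by
        intro z
        obtain ⟨z', hz'⟩ := autTower_conj G γ y z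
        have e1 := congrArg (fun t => f (autTowerMap G h t)) hz'
        have e2 := congrArg (fun t => g (autTowerMap G h t)) hz'
        simp only [map_mul, map_inv, autTowerMap_trans] at e1 e2
        rw [e1, ih hγ z, e2, ih hγ z']
      have h2 := hc ((g (autTowerMap G h y))⁻¹ * f (autTowerMap G h y)) fun x => by
        have := h1 (autTowerIncl G γ x)
        rw [autTowerMap_incl] at this
        rw [commute_iff_eq]
        calc _ = (g (autTowerMap G h y))⁻¹ * (f (autTowerMap G h y) * f (autTowerIncl G β x) *
                (f (autTowerMap G h y))⁻¹) * f (autTowerMap G h y) := by group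
          _ = _ := by rw [this]; group
      exact (inv_mul_eq_one.1 h2).symm
    | limit γ hγ ih =>
      intro h y
      obtain ⟨δ, hδ, z, rfl⟩ := autTower_limit G γ hγ y
      rw [autTowerMap_trans]
      exact ih δ hδ _ z
  ext x
  simpa only [autTowerMap_self] using key β le_rfl x

/-- The two claims are proved together because each feeds the other: the kernel of `G_β → Aut G_β`
centralizes `G`, and at limits the centralizer claim is pulled back to an earlier stage by
injectivity. -/
theorem autTower_centralizer_and_injective (G : Type u) [Group G] (hG : Subgroup.center G = ⊥)
    (β : Ordinal.{u}) :
    (∀ z : AutTowerGroup G β, (∀ x, Commute z (autTowerIncl G β x)) → z = 1) ∧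
    ∀ (γ : Ordinal.{u}) (h : γ ≤ β), Function.Injective (autTowerMap G h) := by
  induction β using ordinal_limit_induction with
  | zero =>
    constructor
    · intro z hz
      obtain ⟨y, rfl⟩ := (autTowerIncl_zero_bijective G).2 z
      have : y ∈ Subgroup.center G := by
        rw [Subgroup.mem_center_iff]
        intro x
        apply (autTowerIncl_zero_bijective G).1
        rw [map_mul, map_mul]
        exact (hz x).eq.symm
      rw [hG, Subgroup.mem_bot] at this
      rw [this, map_one]
    · intro γ h
      obtain rfl : γ = 0 := le_antisymm h bot_le
      intro x y hxy
      rwa [autTowerMap_self, autTowerMap_self] at hxy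
  | succ β ih =>
    obtain ⟨ih1, ih2⟩ := ih
    obtain ⟨φ, hφ⟩ := autTower_succ G β
    have hconj : ∀ x y : AutTowerGroup G β, MulAut.conj x = MulAut.conj y → x = y := by
      intro x y hxy
      refine (inv_mul_eq_one.1 (ih1 (y⁻¹ * x) fun w => ?_)).symm
      have := DFunLike.congr_fun hxy (autTowerIncl G β w)
      simp only [MulAut.conj_apply] at this
      rw [commute_iff_eq]
      calc _ = y⁻¹ * (x * autTowerIncl G β w * x⁻¹) * x := by group
        _ = _ := by rw [this]; group
    have hinj : Function.Injective (autTowerMap G (Order.le_succ β)) := by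
      intro x y hxy
      apply hconj
      rw [← hφ, ← hφ, hxy]
    constructor
    · intro z hz
      -- An automorphism commuting with the inner automorphisms from `G` fixes `G` pointwise, so by
      -- `autTower_hom_ext` it is the identity on `G_β`.
      have hfix : ∀ x, φ z (autTowerIncl G β x) = autTowerIncl G β x := by
        intro x
        apply hconj
        have h1 := (hz x).eq
        rw [← autTowerMap_incl G (Order.le_succ β)] at h1
        have h2 := congrArg φ h1
        rw [map_mul, map_mul, hφ] at h2
        have h3 : MulAut.conj (φ z (autTowerIncl G β x)) =
            φ z * MulAut.conj (autTowerIncl G β x) * (φ z)⁻¹ := by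
          ext w
          simp
        rw [h3, h2]
        simp
      have hid : (φ z).toMonoidHom = MonoidHom.id _ := by
        refine autTower_hom_ext G hfix fun w hw => ih1 w fun x => ?_
        rw [← hfix x]
        exact hw x
      apply φ.injective
      rw [map_one]
      ext w
      exact DFunLike.congr_fun hid w
    · intro γ h
      rcases h.eq_or_lt with rfl | h'
      · intro x y hxy
        rwa [autTowerMap_self, autTowerMap_self] at hxy
      · have hγ := Order.lt_succ_iff.1 h'
        intro x y hxy
        rw [← autTowerMap_trans G hγ (Order.le_succ β), ← autTowerMap_trans G hγ (Order.le_succ β)]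
          at hxy
        exact ih2 γ hγ (hinj hxy)
  | limit δ hδ ih =>
    have hinj : ∀ (γ : Ordinal.{u}) (h : γ ≤ δ), Function.Injective (autTowerMap G h) := by
      intro γ h x y hxy
      rcases h.eq_or_lt with rfl | h'
      · rwa [autTowerMap_self, autTowerMap_self] at hxy
      · obtain ⟨γ', h1, h2, h3⟩ := autTower_limit_eq G δ hδ h' x y hxy
        exact (ih γ' h1).2 γ h2 h3
    refine ⟨fun z hz => ?_, hinj⟩
    obtain ⟨γ, hγ, y, rfl⟩ := autTower_limit G δ hδ z
    rw [(ih γ hγ).1 y, map_one]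
    intro x
    apply hinj γ hγ.le
    rw [map_mul, map_mul, autTowerMap_incl]
    exact (hz x).eq

theorem autTower_eq_one_of_commute {G : Type u} [Group G] (hG : Subgroup.center G = ⊥)
    {β : Ordinal.{u}} {z : AutTowerGroup G β} (hz : ∀ x, Commute z (autTowerIncl G β x)) : z = 1 :=
  (autTower_centralizer_and_injective G hG β).1 z hz

theorem autTowerMap_injective {G : Type u} [Group G] (hG : Subgroup.center G = ⊥)
    {γ β : Ordinal.{u}} (h : γ ≤ β) : Function.Injective (autTowerMap G h) :=
  (autTower_centralizer_and_injective G hG β).2 γ h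

theorem autTower_center {G : Type u} [Group G] (hG : Subgroup.center G = ⊥) (β : Ordinal.{u}) :
    Subgroup.center (AutTowerGroup G β) = ⊥ := by
  rw [eq_bot_iff]
  intro z hz
  exact autTower_eq_one_of_commute hG fun x => (Subgroup.mem_center_iff.1 hz _).symm

/-! ### Even permutations: generators, trivial centralizer, simplicity -/

section

open Equiv

variable {Ω : Type u}

open Classical in
/-- The permutation `(a b c)`, a 3-cycle if the three points are distinct. -/
noncomputable def threeCycle (a b c : Ω) : Perm Ω := swap a b * swap b c

open Classical in
theorem swap_mul_swap_mem_altGroup {a b c d : Ω} (hab : a ≠ b) (hcd : c ≠ d) :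
    swap a b * swap c d ∈ altGroup Ω :=
  by
  refine ⟨[swap a b, swap c d], ?_, by simp, by simp⟩
  intro g hg
  rcases List.mem_pair.1 hg with rfl | rfl
  exacts [⟨a, b, hab, rfl⟩, ⟨c, d, hcd, rfl⟩]

theorem threeCycle_mem {a b c : Ω} (hab : a ≠ b) (hbc : b ≠ c) : threeCycle a b c ∈ altGroup Ω :=
  swap_mul_swap_mem_altGroup hab hbc

open Classical in
theorem threeCycle_apply_fst {a b c : Ω} (hab : a ≠ b) (hac : a ≠ c) :
    threeCycle a b c a = b := by
  simp [threeCycle, swap_apply_of_ne_of_ne hab hac]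

open Classical in
theorem threeCycle_apply_snd {a b c : Ω} (hac : a ≠ c) (hbc : b ≠ c) :
    threeCycle a b c b = c := by
  simp [threeCycle, swap_apply_of_ne_of_ne hac.symm (Ne.symm hbc)]

theorem threeCycle_apply_trd (a b c : Ω) : threeCycle a b c c = a := by
  simp [threeCycle]

open Classical in
theorem threeCycle_apply_of_ne {a b c x : Ω} (ha : x ≠ a) (hb : x ≠ b) (hc : x ≠ c) :
    threeCycle a b c x = x := by
  simp [threeCycle, swap_apply_of_ne_of_ne hb hc, swap_apply_of_ne_of_ne ha hb]

theorem conj_threeCycle (g : Perm Ω) (a b c : Ω) :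
    g * threeCycle a b c * g⁻¹ = threeCycle (g a) (g b) (g c) := by
  simp only [threeCycle, swap_apply_apply]
  group

open Classical in
/-- A subgroup that contains all products of two transpositions contains the alternating group. -/
theorem altGroup_le_of_swap_mul_swap_mem {M : Subgroup (Perm Ω)}
    (h : ∀ a b c d : Ω, a ≠ b → c ≠ d → swap a b * swap c d ∈ M) : altGroup Ω ≤ M := by
  rintro _ ⟨l, hl, ⟨n, hn⟩, rfl⟩
  induction n generalizing l with
  | zero =>
    obtain rfl : l = [] := List.length_eq_zero_iff.1 (by simpa using hn)
    simp
  | succ n ih =>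
    match l, hl, hn with
    | [], _, _ => simp
    | [x], _, hn => simp at hn; omega
    | x :: y :: l, hl, hn =>
      obtain ⟨a, b, hab, rfl⟩ := hl x (by simp)
      obtain ⟨c, d, hcd, rfl⟩ := hl y (by simp)
      rw [List.prod_cons, List.prod_cons, ← mul_assoc]
      exact M.mul_mem (h a b c d hab hcd)
        (ih l (fun g hg => hl g (by simp [hg])) (by simp at hn; omega))

open Classical in
/-- The 3-cycles `(a b d)`, for fixed `a` and `b`, generate the alternating group. -/
theorem altGroup_le_of_threeCycle_mem {a b : Ω} (hab : a ≠ b) {M : Subgroup (Perm Ω)}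
    (h : ∀ d, a ≠ d → b ≠ d → threeCycle a b d ∈ M) : altGroup Ω ≤ M := by
  have h1 : ∀ d, b ≠ d → swap a b * swap b d ∈ M := by
    intro d hbd
    by_cases had : a = d
    · subst had
      rw [swap_comm b a, swap_mul_self]
      exact M.one_mem
    · exact h d had hbd
  have h3 : ∀ x y, x ≠ y → swap a b * swap x y ∈ M := by
    intro x y hxy
    by_cases hxb : x = b
    · subst hxb; exact h1 y hxy
    by_cases hyb : y = b
    · subst hyb; rw [swap_comm x y]; exact h1 x hxy.symm
    -- Write `(x y) = (b x)(b y)(b x)` and insert `(a b)(a b) = 1` before the last factor.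
    have e : swap a b * swap x y =
        (swap a b * swap b x) * (swap a b * swap b y)⁻¹ * (swap a b * swap b x) := by
      have e0 : swap x y = swap b x * swap b y * swap b x := by
        rw [swap_comm b y, swap_mul_swap_mul_swap hyb hxy.symm]
      rw [e0]
      simp [mul_assoc]
    rw [e]
    exact M.mul_mem (M.mul_mem (h1 x (Ne.symm hxb)) (M.inv_mem (h1 y (Ne.symm hyb))))
      (h1 x (Ne.symm hxb))
  apply altGroup_le_of_swap_mul_swap_mem
  intro x y z w hxy hzw
  have : swap x y * swap z w = (swap a b * swap x y)⁻¹ * (swap a b * swap z w) := by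
    simp [mul_assoc]
  rw [this]
  exact M.mul_mem (M.inv_mem (h3 x y hxy)) (h3 z w hzw)

theorem altGroup_conj_mem (g : Perm Ω) {a : Perm Ω} (ha : a ∈ altGroup Ω) :
    g * a * g⁻¹ ∈ altGroup Ω := by
  obtain ⟨l, hl, he, rfl⟩ := ha
  refine ⟨l.map (MulAut.conj g), ?_, by simpa using he, ?_⟩
  · intro x hx
    obtain ⟨y, hy, rfl⟩ := List.mem_map.1 hx
    obtain ⟨a, b, hab, rfl⟩ := hl y hy
    exact ⟨g a, g b, g.injective.ne hab, by simp [swap_apply_apply]⟩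
  · rw [List.prod_hom, MulAut.conj_apply]

instance altGroup_normal : (altGroup Ω).Normal := ⟨fun _ ha g => altGroup_conj_mem g ha⟩

theorem finite_moved_of_mem_altGroup {a : Perm Ω} (ha : a ∈ altGroup Ω) :
    {x | a x ≠ x}.Finite := by
  classical
  obtain ⟨l, hl, -, rfl⟩ := ha
  exact mem_closure_isSwap'.1 (Subgroup.list_prod_mem _ fun g hg =>
    Subgroup.subset_closure (hl g hg))

/-- The product of two odd finitary permutations is even. -/
theorem mul_mem_altGroup_of_not_mem {a b : Perm Ω} (ha : {x | a x ≠ x}.Finite)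
    (hb : {x | b x ≠ x}.Finite) (ha' : a ∉ altGroup Ω) (hb' : b ∉ altGroup Ω) :
    a * b ∈ altGroup Ω := by
  classical
  have key : ∀ a : Perm Ω, {x | a x ≠ x}.Finite →
      ∃ l : List (Perm Ω), (∀ g ∈ l, g.IsSwap) ∧ l.prod = a := by
    intro a ha
    have h1 : a ∈ Subgroup.closure {σ : Perm Ω | σ.IsSwap} := mem_closure_isSwap'.2 ha
    clear ha
    induction h1 using Subgroup.closure_induction with
    | mem x hx => exact ⟨[x], by simpa using hx, by simp⟩
    | one => exact ⟨[], by simp, rfl⟩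
    | mul x y _ _ hx hy =>
      obtain ⟨l, hl, rfl⟩ := hx
      obtain ⟨m, hm, rfl⟩ := hy
      refine ⟨l ++ m, fun g hg => ?_, List.prod_append⟩
      rcases List.mem_append.1 hg with h | h
      exacts [hl g h, hm g h]
    | inv x _ hx =>
      obtain ⟨l, hl, rfl⟩ := hx
      refine ⟨(l.map fun x => x⁻¹).reverse, ?_, (List.prod_inv_reverse l).symm⟩
      intro g hg
      obtain ⟨x, hx, rfl⟩ := List.mem_map.1 (List.mem_reverse.1 hg)
      obtain ⟨a, b, hab, rfl⟩ := hl x hx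
      exact ⟨a, b, hab, swap_inv a b⟩
  obtain ⟨l, hl, rfl⟩ := key a ha
  obtain ⟨m, hm, rfl⟩ := key b hb
  have h1 : ¬ Even l.length := fun h => ha' ⟨l, hl, h, rfl⟩
  have h2 : ¬ Even m.length := fun h => hb' ⟨m, hm, h, rfl⟩
  refine ⟨l ++ m, ?_, ?_, List.prod_append⟩
  · intro g hg
    rcases List.mem_append.1 hg with h | h
    exacts [hl g h, hm g h]
  · rw [List.length_append, Nat.even_add]
    tauto

theorem exists_notMem_moved [Infinite Ω] {a : Perm Ω} (ha : {x | a x ≠ x}.Finite)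
    (s : Finset Ω) : ∃ p, a p = p ∧ p ∉ s := by
  obtain ⟨p, hp⟩ := (ha.union s.finite_toSet).exists_notMem
  simp only [Set.mem_union, Set.mem_ofPred_eq, not_or, not_not, Finset.mem_coe] at hp
  exact ⟨p, hp⟩

/-- The centralizer of the alternating group is trivial. -/
theorem eq_one_of_commute_altGroup [Infinite Ω] {g : Perm Ω}
    (hg : ∀ a ∈ altGroup Ω, Commute g a) : g = 1 := by
  classical
  ext x
  by_contra hx
  rw [Perm.one_apply] at hx
  obtain ⟨y, hy⟩ := Infinite.exists_notMem_finset {x, g x, g⁻¹ x}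
  obtain ⟨z, hz⟩ := Infinite.exists_notMem_finset {x, g x, y}
  simp only [Finset.mem_insert, Finset.mem_singleton, not_or] at hy hz
  have hxy : x ≠ y := Ne.symm hy.1
  have hyz : y ≠ z := Ne.symm hz.2.2
  have h := (hg _ (threeCycle_mem hxy hyz)).eq
  -- The 3-cycle `(x y z)` moves `x` but fixes `g x`, which is impossible for a permutation
  -- commuting with `g`.
  have h1 := DFunLike.congr_fun h x
  rw [Perm.mul_apply, Perm.mul_apply, threeCycle_apply_fst hxy (Ne.symm hz.1),
    threeCycle_apply_of_ne hx (Ne.symm hy.2.1) (Ne.symm hz.2.1)] at h1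
  exact hxy (g.injective h1.symm)

/-- The alternating group of an infinite set is simple. -/
theorem altGroup_le_of_conj_mem [Infinite Ω] {M : Subgroup (Perm Ω)}
    (hM : ∀ a ∈ M, ∀ g ∈ altGroup Ω, g * a * g⁻¹ ∈ M) {σ : Perm Ω} (hσM : σ ∈ M)
    (hσ : σ ∈ altGroup Ω) (hσ1 : σ ≠ 1) : altGroup Ω ≤ M := by
  classical
  have hf := finite_moved_of_mem_altGroup hσ
  obtain ⟨a, ha⟩ : ∃ a, σ a ≠ a := by
    by_contra! h
    exact hσ1 (Perm.ext h)
  obtain ⟨x, hx, hxs⟩ := exists_notMem_moved hf {a, σ a}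
  obtain ⟨y, hy, hys⟩ := exists_notMem_moved hf {a, σ a, x}
  simp only [Finset.mem_insert, Finset.mem_singleton, not_or] at hxs hys
  obtain ⟨hxa, hxb⟩ := hxs
  obtain ⟨hya, hyb, hyx⟩ := hys
  have hc : threeCycle a (σ a) x ∈ M := by
    have hτ := threeCycle_mem (Ne.symm hxa) (Ne.symm hyx)
    -- As `σ` fixes `x` and `y`, its commutator with `(a x y)` is `(σa x y)(a x y)⁻¹ = (a σa x)`.
    have e : threeCycle a (σ a) x =
        σ * (threeCycle a x y * σ * (threeCycle a x y)⁻¹)⁻¹ := by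
      have e1 : σ * (threeCycle a x y * σ * (threeCycle a x y)⁻¹)⁻¹ =
          (σ * threeCycle a x y * σ⁻¹) * (threeCycle a x y)⁻¹ := by group
      rw [e1, conj_threeCycle, hx, hy, eq_mul_inv_iff_mul_eq]
      ext w
      rw [Perm.mul_apply]
      by_cases h1 : w = a
      · rw [h1, threeCycle_apply_fst (Ne.symm hxa) (Ne.symm hya), threeCycle_apply_trd,
          threeCycle_apply_of_ne ha.symm (Ne.symm hxa) (Ne.symm hya)]
      by_cases h2 : w = x
      · rw [h2, threeCycle_apply_snd (Ne.symm hya) (Ne.symm hyx),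
          threeCycle_apply_of_ne hya hyb hyx, threeCycle_apply_snd (Ne.symm hyb) (Ne.symm hyx)]
      by_cases h3 : w = y
      · rw [h3, threeCycle_apply_trd, threeCycle_apply_fst ha.symm (Ne.symm hxa),
          threeCycle_apply_trd]
      rw [threeCycle_apply_of_ne h1 h2 h3]
      by_cases h4 : w = σ a
      · rw [h4, threeCycle_apply_snd (Ne.symm hxa) (Ne.symm hxb),
          threeCycle_apply_fst (Ne.symm hxb) (Ne.symm hyb)]
      · rw [threeCycle_apply_of_ne h1 h4 h2, threeCycle_apply_of_ne h4 h2 h3]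
    rw [e]
    exact M.mul_mem hσM (M.inv_mem (hM _ hσM _ hτ))
  refine altGroup_le_of_threeCycle_mem ha.symm fun d had hbd => ?_
  by_cases hxd : x = d
  · rw [← hxd]; exact hc
  obtain ⟨p, hp⟩ := Infinite.exists_notMem_finset {a, σ a, x, d}
  obtain ⟨q, hq⟩ := Infinite.exists_notMem_finset {a, σ a, x, d, p}
  simp only [Finset.mem_insert, Finset.mem_singleton, not_or] at hp hq
  -- Conjugation by `(x d)` is what is needed; `(p q)`, away from all points involved, makes the
  -- conjugator even.
  have h := hM _ hc _ (swap_mul_swap_mem_altGroup (Ne.symm hq.2.2.2.2) hxd)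
  rw [conj_threeCycle] at h
  simp only [Perm.mul_apply, swap_apply_left] at h
  rwa [swap_apply_of_ne_of_ne (a := x) (b := d) (Ne.symm hxa) had,
    swap_apply_of_ne_of_ne (a := x) (b := d) (Ne.symm hxb) hbd,
    swap_apply_of_ne_of_ne (Ne.symm hp.1) (Ne.symm hq.1),
    swap_apply_of_ne_of_ne (Ne.symm hp.2.1) (Ne.symm hq.2.1),
    swap_apply_of_ne_of_ne (Ne.symm hp.2.2.2) (Ne.symm hq.2.2.2.1)] at h

end

/-! ### Recognizing 3-cycles by orders of products -/

section

open Equiv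

variable {Ω : Type u}

/-- `σ` is a 3-cycle, on a possibly infinite set. -/
def IsThreeCyclePerm (σ : Perm Ω) : Prop :=
  ∃ a b c : Ω, a ≠ b ∧ a ≠ c ∧ b ≠ c ∧ σ = threeCycle a b c

theorem threeCycle_spec {a b c : Ω} (hab : a ≠ b) (hac : a ≠ c) (hbc : b ≠ c) :
    threeCycle a b c a = b ∧ threeCycle a b c b = c ∧ threeCycle a b c c = a ∧
    ∀ x, x ≠ a → x ≠ b → x ≠ c → threeCycle a b c x = x :=
  ⟨threeCycle_apply_fst hab hac, threeCycle_apply_snd hac hbc, threeCycle_apply_trd a b c,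
    fun _ => threeCycle_apply_of_ne⟩

theorem eq_threeCycle_of_apply {σ : Perm Ω} {a b c : Ω} (hab : a ≠ b) (hac : a ≠ c) (hbc : b ≠ c)
    (h1 : σ a = b) (h2 : σ b = c) (h3 : σ c = a) (h4 : ∀ x, x ≠ a → x ≠ b → x ≠ c → σ x = x) :
    σ = threeCycle a b c := by
  obtain ⟨k1, k2, k3, k4⟩ := threeCycle_spec hab hac hbc
  ext x
  by_cases ha : x = a
  · rw [ha, h1, k1]
  by_cases hb : x = b
  · rw [hb, h2, k2]
  by_cases hc : x = c
  · rw [hc, h3, k3]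
  rw [h4 x ha hb hc, k4 x ha hb hc]

theorem threeCycle_rotate {a b c : Ω} (hab : a ≠ b) (hac : a ≠ c) (hbc : b ≠ c) :
    threeCycle a b c = threeCycle b c a := by
  obtain ⟨k1, k2, k3, k4⟩ := threeCycle_spec hab hac hbc
  exact eq_threeCycle_of_apply hbc hab.symm hac.symm k2 k3 k1 fun x h1 h2 h3 => k4 x h3 h1 h2

theorem IsThreeCyclePerm.exists_eq {σ : Perm Ω} (h : IsThreeCyclePerm σ) {p : Ω} (hp : σ p ≠ p) :
    ∃ b c : Ω, p ≠ b ∧ p ≠ c ∧ b ≠ c ∧ σ = threeCycle p b c := by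
  obtain ⟨a, b, c, hab, hac, hbc, rfl⟩ := h
  by_cases h1 : p = a
  · subst h1; exact ⟨b, c, hab, hac, hbc, rfl⟩
  by_cases h2 : p = b
  · subst h2; exact ⟨c, a, hbc, hab.symm, hac.symm, threeCycle_rotate hab hac hbc⟩
  by_cases h3 : p = c
  · subst h3
    exact ⟨a, b, hac.symm, hbc.symm, hab, (threeCycle_rotate hac.symm hbc.symm hab).symm⟩
  exact absurd (threeCycle_apply_of_ne h1 h2 h3) hp

/-- The product of `σ` and `τ` has order 1, 2, 3, 5 or 6, and if the order is 2, then the two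
permutations agree at a point that they move. -/
def ThreeCycleProductSpec (σ τ : Perm Ω) : Prop :=
  ((σ * τ) ^ 6 = 1 ∨ (σ * τ) ^ 5 = 1) ∧
    ((σ * τ) ^ 2 = 1 → σ * τ ≠ 1 → ∃ p, σ p = τ p ∧ σ p ≠ p)

theorem threeCycleProductSpec_of_disjoint {a b c x y z : Ω} (hab : a ≠ b) (hac : a ≠ c) (hbc : b ≠ c)
    (hxy : x ≠ y) (hxz : x ≠ z) (hyz : y ≠ z) (hax : a ≠ x) (hay : a ≠ y) (haz : a ≠ z)
    (hbx : b ≠ x) (hby : b ≠ y) (hbz : b ≠ z) (hcx : c ≠ x) (hcy : c ≠ y) (hcz : c ≠ z) :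
    ThreeCycleProductSpec (threeCycle a b c) (threeCycle x y z) := by
  obtain ⟨k1, k2, k3, k4⟩ := threeCycle_spec hab hac hbc
  obtain ⟨l1, l2, l3, l4⟩ := threeCycle_spec hxy hxz hyz
  generalize threeCycle a b c = σ at *
  generalize threeCycle x y z = τ at *
  constructor
  · left
    ext w
    simp only [pow_succ, pow_zero, one_mul, Perm.mul_apply, Perm.one_apply]
    by_cases ea : w = a
    · subst ea; grind
    by_cases eb : w = b
    · subst eb; grind
    by_cases ec : w = c
    · subst ec; grind
    by_cases ex : w = x
    · subst ex; grind
    by_cases ey : w = y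
    · subst ey; grind
    by_cases ez : w = z
    · subst ez; grind
    have hσ : σ w = w := by grind
    have hτ : τ w = w := by grind
    simp only [hσ, hτ]
  · intro h
    have := DFunLike.congr_fun h a
    simp only [pow_succ, pow_zero, one_mul, Perm.mul_apply, Perm.one_apply] at this
    grind

theorem threeCycleProductSpec_of_common_point {a b c x y : Ω} (hab : a ≠ b) (hac : a ≠ c) (hbc : b ≠ c)
    (hax : a ≠ x) (hay : a ≠ y) (hxy : x ≠ y)
    (hbx : b ≠ x) (hby : b ≠ y) (hcx : c ≠ x) (hcy : c ≠ y) :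
    ThreeCycleProductSpec (threeCycle a b c) (threeCycle a x y) := by
  obtain ⟨k1, k2, k3, k4⟩ := threeCycle_spec hab hac hbc
  obtain ⟨l1, l2, l3, l4⟩ := threeCycle_spec hax hay hxy
  generalize threeCycle a b c = σ at *
  generalize threeCycle a x y = τ at *
  constructor
  · right
    ext w
    simp only [pow_succ, pow_zero, one_mul, Perm.mul_apply, Perm.one_apply]
    by_cases ea : w = a
    · subst ea; grind
    by_cases eb : w = b
    · subst eb; grind
    by_cases ec : w = c
    · subst ec; grind
    by_cases ex : w = x
    · subst ex; grind
    by_cases ey : w = y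
    · subst ey; grind
    have hσ : σ w = w := by grind
    have hτ : τ w = w := by grind
    simp only [hσ, hτ]
  · intro h
    have := DFunLike.congr_fun h a
    simp only [pow_succ, pow_zero, one_mul, Perm.mul_apply, Perm.one_apply] at this
    grind

theorem threeCycleProductSpec_of_common_edge {a b c x : Ω} (hab : a ≠ b) (hac : a ≠ c) (hbc : b ≠ c)
    (hax : a ≠ x) (hbx : b ≠ x) :
    ThreeCycleProductSpec (threeCycle a b c) (threeCycle a b x) := by
  obtain ⟨k1, k2, k3, k4⟩ := threeCycle_spec hab hac hbc
  obtain ⟨l1, l2, l3, l4⟩ := threeCycle_spec hab hax hbx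
  generalize threeCycle a b c = σ at *
  generalize threeCycle a b x = τ at *
  constructor
  · left
    ext w
    have hxc : x = c ∨ x ≠ c := em _
    simp only [pow_succ, pow_zero, one_mul, Perm.mul_apply, Perm.one_apply]
    by_cases ea : w = a
    · subst ea; rcases hxc with hxc | hxc <;> grind
    by_cases eb : w = b
    · subst eb; rcases hxc with hxc | hxc <;> grind
    by_cases ec : w = c
    · subst ec; rcases hxc with hxc | hxc <;> grind
    by_cases ex : w = x
    · subst ex; rcases hxc with hxc | hxc <;> grind
    have hσ : σ w = w := by grind
    have hτ : τ w = w := by grind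
    simp only [hσ, hτ]
  · exact fun _ _ => ⟨a, by rw [k1, l1], by rw [k1]; exact hab.symm⟩

theorem threeCycleProductSpec_of_opposite_edge {a b c x : Ω} (hab : a ≠ b) (hac : a ≠ c) (hbc : b ≠ c)
    (hax : a ≠ x) (hbx : b ≠ x) :
    ThreeCycleProductSpec (threeCycle a b c) (threeCycle b a x) := by
  obtain ⟨k1, k2, k3, k4⟩ := threeCycle_spec hab hac hbc
  obtain ⟨l1, l2, l3, l4⟩ := threeCycle_spec hab.symm hbx hax
  generalize threeCycle a b c = σ at *
  generalize threeCycle b a x = τ at *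
  constructor
  · left
    ext w
    have hxc : x = c ∨ x ≠ c := em _
    simp only [pow_succ, pow_zero, one_mul, Perm.mul_apply, Perm.one_apply]
    by_cases ea : w = a
    · subst ea; rcases hxc with hxc | hxc <;> grind
    by_cases eb : w = b
    · subst eb; rcases hxc with hxc | hxc <;> grind
    by_cases ec : w = c
    · subst ec; rcases hxc with hxc | hxc <;> grind
    by_cases ex : w = x
    · subst ex; rcases hxc with hxc | hxc <;> grind
    have hσ : σ w = w := by grind
    have hτ : τ w = w := by grind
    simp only [hσ, hτ]
  · intro h h'
    have h1 := DFunLike.congr_fun h a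
    simp only [pow_succ, pow_zero, one_mul, Perm.mul_apply, Perm.one_apply] at h1
    by_cases hxc : x = c
    · exfalso
      apply h'
      ext w
      rw [Perm.mul_apply, Perm.one_apply]
      by_cases ea : w = a
      · subst ea; grind
      by_cases eb : w = b
      · subst eb; grind
      by_cases ec : w = c
      · subst ec; grind
      by_cases ex : w = x
      · subst ex; grind
      rw [l4 w eb ea ex, k4 w ea eb ec]
    · grind

/-- The cases are the possible overlaps. Disjoint 3-cycles have a product of order 3, and one common
point gives a 5-cycle. Two common points give order 2 if the cycles share a directed edge and order
3 if they traverse it in opposite directions. With the same three points the cycles are equal or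
inverse, and the product has order 3 or 1. -/
theorem IsThreeCyclePerm.spec {σ τ : Perm Ω} (hσ : IsThreeCyclePerm σ) (hτ : IsThreeCyclePerm τ) :
    ThreeCycleProductSpec σ τ := by
  by_cases h : ∃ p, σ p ≠ p ∧ τ p ≠ p
  · obtain ⟨a, h1, h2⟩ := h
    obtain ⟨b, c, hab, hac, hbc, rfl⟩ := hσ.exists_eq h1
    obtain ⟨y, z, hay, haz, hyz, rfl⟩ := hτ.exists_eq h2
    by_cases hyb : b = y
    · subst hyb
      exact threeCycleProductSpec_of_common_edge hab hac hbc haz hyz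
    by_cases hyc : c = y
    · subst hyc
      rw [← threeCycle_rotate hac.symm hbc.symm hab]
      exact threeCycleProductSpec_of_opposite_edge hac.symm hbc.symm hab hyz haz
    by_cases hzb : b = z
    · subst hzb
      rw [← threeCycle_rotate haz.symm hyz.symm hay]
      exact threeCycleProductSpec_of_opposite_edge hab hac hbc hay hyb
    by_cases hzc : c = z
    · subst hzc
      rw [← threeCycle_rotate hac.symm hbc.symm hab, ← threeCycle_rotate haz.symm hyz.symm hay]
      exact threeCycleProductSpec_of_common_edge hac.symm hbc.symm hab hyz.symm hay
    exact threeCycleProductSpec_of_common_point hab hac hbc hay haz hyz hyb hzb hyc hzc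
  · obtain ⟨a, b, c, hab, hac, hbc, rfl⟩ := hσ
    obtain ⟨x, y, z, hxy, hxz, hyz, rfl⟩ := hτ
    obtain ⟨k1, k2, k3, k4⟩ := threeCycle_spec hab hac hbc
    obtain ⟨l1, l2, l3, l4⟩ := threeCycle_spec hxy hxz hyz
    push Not at h
    have ha := h a (by rw [k1]; exact hab.symm)
    have hb := h b (by rw [k2]; exact hbc.symm)
    have hc := h c (by rw [k3]; exact hac)
    refine threeCycleProductSpec_of_disjoint hab hac hbc hxy hxz hyz ?_ ?_ ?_ ?_ ?_ ?_ ?_ ?_ ?_ <;>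
      (rintro rfl; grind)

/-- Among the even permutations of an infinite set, the 3-cycles are characterized by the orders of
products of two conjugates. -/
theorem isThreeCyclePerm_iff [Infinite Ω] {σ : Perm Ω} (hσ : σ ∈ altGroup Ω) :
    IsThreeCyclePerm σ ↔ σ ≠ 1 ∧ σ ^ 3 = 1 ∧ ∀ g ∈ altGroup Ω,
      (σ * (g * σ * g⁻¹)) ^ 6 = 1 ∨ (σ * (g * σ * g⁻¹)) ^ 5 = 1 := by
  classical
  constructor
  · intro h
    have hconj : ∀ g : Perm Ω, IsThreeCyclePerm (g * σ * g⁻¹) := by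
      intro g
      obtain ⟨a, b, c, hab, hac, hbc, rfl⟩ := h
      exact ⟨g a, g b, g c, g.injective.ne hab, g.injective.ne hac, g.injective.ne hbc,
        conj_threeCycle g a b c⟩
    refine ⟨?_, ?_, fun g _ => (h.spec (hconj g)).1⟩
    · rintro rfl
      obtain ⟨a, b, c, hab, hac, hbc, h⟩ := h
      have := DFunLike.congr_fun h a
      rw [threeCycle_apply_fst hab hac] at this
      exact hab this
    · obtain ⟨a, b, c, hab, hac, hbc, rfl⟩ := h
      obtain ⟨k1, k2, k3, k4⟩ := threeCycle_spec hab hac hbc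
      ext w
      simp only [pow_succ, pow_zero, one_mul, Perm.mul_apply, Perm.one_apply]
      by_cases ea : w = a
      · rw [ea, k1, k2, k3]
      by_cases eb : w = b
      · rw [eb, k2, k3, k1]
      by_cases ec : w = c
      · rw [ec, k3, k1, k2]
      rw [k4 w ea eb ec, k4 w ea eb ec, k4 w ea eb ec]
  · rintro ⟨h1, h3, h⟩
    have h3' : ∀ x, σ (σ (σ x)) = x := by
      intro x
      have := DFunLike.congr_fun h3 x
      simpa only [pow_succ, pow_zero, one_mul, Perm.mul_apply, Perm.one_apply] using this
    obtain ⟨a, ha⟩ : ∃ a, σ a ≠ a := by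
      by_contra! h
      exact h1 (Perm.ext h)
    have hac : a ≠ σ (σ a) := by
      intro h
      apply ha
      conv_lhs => rw [h]
      exact h3' a
    have hbc : σ a ≠ σ (σ a) := fun h => ha (σ.injective h).symm
    by_cases hd : ∀ d, d ≠ a → d ≠ σ a → d ≠ σ (σ a) → σ d = d
    · exact ⟨a, σ a, σ (σ a), ha.symm, hac, hbc,
        eq_threeCycle_of_apply ha.symm hac hbc rfl rfl (h3' a) hd⟩
    exfalso
    push Not at hd
    obtain ⟨d, hda, hdb, hdc, hd⟩ := hd
    have hf := finite_moved_of_mem_altGroup hσ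
    generalize hb : σ a = b at *
    generalize hc : σ b = c at *
    have hca : σ c = a := by rw [← hc, ← hb]; exact h3' a
    -- If `σ` has a second 3-cycle through `d`, conjugating by `(b p)(c q)` replaces `(a b c)` by
    -- `(a p q)` and leaves the other cycles alone. The product is then a 5-cycle on `a, p, q, b, c`
    -- and equals `σ²` on the other cycles of `σ`.
    obtain ⟨p, hp, hps⟩ := exists_notMem_moved hf {a, b, c, d}
    obtain ⟨q, hq, hqs⟩ := exists_notMem_moved hf {a, b, c, d, p}
    simp only [Finset.mem_insert, Finset.mem_singleton, not_or] at hps hqs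
    obtain ⟨hpa, hpb, hpc, hpd⟩ := hps
    obtain ⟨hqa, hqb, hqc, hqd, hqp⟩ := hqs
    have hg := swap_mul_swap_mem_altGroup (Ne.symm hpb) (Ne.symm hqc)
    have hspec : ∃ τ : Perm Ω, ((σ * τ) ^ 6 = 1 ∨ (σ * τ) ^ 5 = 1) ∧
        τ a = p ∧ τ p = q ∧ τ q = a ∧ τ b = b ∧ τ c = c ∧
        ∀ x, x ≠ a → x ≠ b → x ≠ c → σ x ≠ x → τ x = σ x := by
      refine ⟨_, h _ hg, ?_⟩
      have hinv : (swap b p * swap c q)⁻¹ = swap c q * swap b p := by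
        rw [mul_inv_rev, swap_inv, swap_inv]
      simp only [hinv, Perm.mul_apply]
      refine ⟨?_, ?_, ?_, ?_, ?_, ?_⟩
      · simp only [swap_apply_def]; grind
      · simp only [swap_apply_def]; grind
      · simp only [swap_apply_def]; grind
      · simp only [swap_apply_def]; grind
      · simp only [swap_apply_def]; grind
      · intro x hxa hxb hxc hx
        have : x ≠ p := by rintro rfl; exact hx hp
        have : x ≠ q := by rintro rfl; exact hx hq
        have : σ x ≠ b := by rw [← hb]; exact fun h => hxa (σ.injective h)
        have : σ x ≠ c := by rw [← hc]; exact fun h => hxb (σ.injective h)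
        have : σ x ≠ p := by rw [← hp]; exact fun h => ‹x ≠ p› (σ.injective h)
        have : σ x ≠ q := by rw [← hq]; exact fun h => ‹x ≠ q› (σ.injective h)
        simp only [swap_apply_def]; grind
    obtain ⟨τ, hτ, t1, t2, t3, t4, t5, t6⟩ := hspec
    -- The sixth power sends `a` to `p` on the 5-cycle; the fifth power is `σ¹⁰ = σ` on the cycle of
    -- `d`.
    rcases hτ with hτ | hτ
    · have := DFunLike.congr_fun hτ a
      simp only [pow_succ, pow_zero, one_mul, Perm.mul_apply, Perm.one_apply] at this
      rw [t1, hp, t2, hq, t3, hb, t4, hc, t5, hca, t1, hp] at this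
      exact hpa this
    · have hdσ : ∀ x, x ≠ a → x ≠ b → x ≠ c → σ x ≠ x →
          σ x ≠ a ∧ σ x ≠ b ∧ σ x ≠ c ∧ σ (σ x) ≠ σ x := by
        intro x hxa hxb hxc hx
        refine ⟨?_, ?_, ?_, fun h => hx (σ.injective h)⟩
        · rw [← hca]; exact fun h => hxc (σ.injective h)
        · rw [← hb]; exact fun h => hxa (σ.injective h)
        · rw [← hc]; exact fun h => hxb (σ.injective h)
      obtain ⟨e1, e2, e3, e4⟩ := hdσ d hda hdb hdc hd
      obtain ⟨e1', e2', e3', e4'⟩ := hdσ _ e1 e2 e3 e4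
      have := DFunLike.congr_fun hτ d
      simp only [pow_succ, pow_zero, one_mul, Perm.mul_apply, Perm.one_apply] at this
      rw [t6 d hda hdb hdc hd, t6 _ e1' e2' e3' e4', h3' d, t6 _ e1 e2 e3 e4, h3' d,
        t6 d hda hdb hdc hd, t6 _ e1' e2' e3' e4', h3' d] at this
      exact hd this

end

/-! ### Automorphisms of the alternating group -/

section

open Equiv

variable {Ω : Type u}

theorem exists_threeCycle_apply_ne [Infinite Ω] (x : Ω) : ∃ a ∈ altGroup Ω, a x ≠ x := by
  classical
  obtain ⟨y, hy⟩ := Infinite.exists_notMem_finset {x}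
  obtain ⟨z, hz⟩ := Infinite.exists_notMem_finset {x, y}
  simp only [Finset.mem_insert, Finset.mem_singleton, not_or] at hy hz
  refine ⟨_, threeCycle_mem (Ne.symm hy) (Ne.symm hz.2), ?_⟩
  rw [threeCycle_apply_fst (Ne.symm hy) (Ne.symm hz.1)]
  exact hy

theorem threeCycle_common_edge_mul {a b c d : Ω} (hab : a ≠ b) (hac : a ≠ c) (hbc : b ≠ c)
    (had : a ≠ d) (hbd : b ≠ d) (hcd : c ≠ d) :
    (threeCycle a b c * threeCycle a b d) ^ 2 = 1 ∧ threeCycle a b c * threeCycle a b d ≠ 1 := by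
  obtain ⟨k1, k2, k3, k4⟩ := threeCycle_spec hab hac hbc
  obtain ⟨l1, l2, l3, l4⟩ := threeCycle_spec hab had hbd
  constructor
  · ext w
    simp only [pow_succ, pow_zero, one_mul, Perm.mul_apply, Perm.one_apply]
    by_cases ea : w = a
    · rw [ea, l1, k2, l4 c hac.symm hbc.symm hcd, k3]
    by_cases eb : w = b
    · rw [eb, l2, k4 d had.symm hbd.symm hcd.symm, l3, k1]
    by_cases ec : w = c
    · rw [ec, l4 c hac.symm hbc.symm hcd, k3, l1, k2]
    by_cases ed : w = d
    · rw [ed, l3, k1, l2, k4 d had.symm hbd.symm hcd.symm]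
    rw [l4 w ea eb ed, k4 w ea eb ec, l4 w ea eb ed, k4 w ea eb ec]
  · intro h
    have := DFunLike.congr_fun h b
    rw [Perm.mul_apply, Perm.one_apply, l2, k4 d had.symm hbd.symm hcd.symm] at this
    exact hbd this.symm

/-- A 3-cycle that shares an edge with each of `(p q r)` and `(p q s)` contains the edge from
`p` to `q`. -/
theorem IsThreeCyclePerm.apply_eq_of_common_edges {p q r s x y : Ω} {τ : Perm Ω}
    (hτ : IsThreeCyclePerm τ) (hpq : p ≠ q) (hpr : p ≠ r) (hqr : q ≠ r) (hps : p ≠ s) (hqs : q ≠ s)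
    (hrs : r ≠ s) (hx : threeCycle p q r x = τ x) (hx' : threeCycle p q r x ≠ x)
    (hy : threeCycle p q s y = τ y) (hy' : threeCycle p q s y ≠ y) : τ p = q := by
  obtain ⟨k1, k2, k3, k4⟩ := threeCycle_spec hpq hpr hqr
  obtain ⟨l1, l2, l3, l4⟩ := threeCycle_spec hpq hps hqs
  by_cases xp : x = p
  · rw [← xp, ← hx, xp, k1]
  by_cases yp : y = p
  · rw [← yp, ← hy, yp, l1]
  -- Otherwise `τ` sends `q` to `r` or `r` to `p`, and also `q` to `s` or `s` to `p`. Each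
  -- combination would require two values at one point, two preimages of one point, or four moved
  -- points.
  by_cases xq : x = q
  · subst xq
    rw [k2] at hx
    by_cases yq : y = x
    · subst yq
      rw [l2] at hy
      exact absurd (hx.trans hy.symm) hrs
    by_cases ys : y = s
    · subst ys
      rw [l3] at hy
      obtain ⟨b, c, h1, h2, h3, rfl⟩ := hτ.exists_eq (p := x) (by rw [← hx]; exact hqr.symm)
      obtain ⟨m1, m2, m3, m4⟩ := threeCycle_spec h1 h2 h3
      have : b = r := by rw [← m1, hx]
      by_cases yc : y = c
      · rw [yc, m3] at hy
        exact absurd hy hpq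
      · rw [m4 y hqs.symm (by rw [this]; exact hrs.symm) yc] at hy
        exact absurd hy hps
    exact absurd (l4 y yp yq ys) hy'
  by_cases xr : x = r
  · subst xr
    rw [k3] at hx
    by_cases yq : y = q
    · subst yq
      rw [l2] at hy
      obtain ⟨b, c, h1, h2, h3, rfl⟩ := hτ.exists_eq (p := x) (by rw [← hx]; exact hpr)
      obtain ⟨m1, m2, m3, m4⟩ := threeCycle_spec h1 h2 h3
      have : b = p := by rw [← m1, hx]
      by_cases yc : y = c
      · rw [yc, m3] at hy
        exact absurd hy.symm hrs
      · rw [m4 y hqr (by rw [this]; exact hpq.symm) yc] at hy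
        exact absurd hy.symm hqs
    by_cases ys : y = s
    · subst ys
      rw [l3] at hy
      exact absurd (τ.injective (hx.symm.trans hy)) hrs
    exact absurd (l4 y yp yq ys) hy'
  exact absurd (k4 x xp xq xr) hx'

open Classical in
/-- Every automorphism of the alternating group of an infinite set is conjugation by a
permutation. -/
theorem exists_conj_of_mulAut_altGroup [Infinite Ω] (φ : MulAut (altGroup Ω)) :
    ∃ π : Perm Ω, ∀ a : altGroup Ω, (φ a : Perm Ω) = π * a * π⁻¹ := by
  have h3 : ∀ a : altGroup Ω, IsThreeCyclePerm (a : Perm Ω) →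
      IsThreeCyclePerm (φ a : Perm Ω) := by
    intro a ha
    rw [isThreeCyclePerm_iff a.2] at ha
    rw [isThreeCyclePerm_iff (φ a).2]
    obtain ⟨h1, h2, h3⟩ := ha
    have c1 : ∀ x : altGroup Ω, (x : Perm Ω) = 1 ↔ (φ x : Perm Ω) = 1 := by
      intro x
      rw [OneMemClass.coe_eq_one, OneMemClass.coe_eq_one, EmbeddingLike.map_eq_one_iff]
    refine ⟨fun h => h1 ((c1 a).2 h), ?_, ?_⟩
    · have := (c1 (a ^ 3)).1 (by simpa using h2)
      simpa using this
    · intro g hg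
      obtain ⟨g', hg'⟩ := φ.surjective ⟨g, hg⟩
      obtain rfl : (φ g' : Perm Ω) = g := by rw [hg']
      have e := c1 ((a * (g' * a * g'⁻¹)) ^ 6)
      have e' := c1 ((a * (g' * a * g'⁻¹)) ^ 5)
      simp only [map_mul, map_inv, map_pow, Subgroup.coe_mul, Subgroup.coe_inv,
        Subgroup.coe_pow] at e e'
      rw [← e, ← e']
      exact h3 g' g'.2
  obtain ⟨a⟩ : Nonempty Ω := inferInstance
  obtain ⟨b, hb⟩ := Infinite.exists_notMem_finset {a}
  obtain ⟨c, hc⟩ := Infinite.exists_notMem_finset {a, b}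
  obtain ⟨d, hd⟩ := Infinite.exists_notMem_finset {a, b, c}
  simp only [Finset.mem_insert, Finset.mem_singleton, not_or] at hb hc hd
  have hab : a ≠ b := Ne.symm hb
  let T : ∀ x : Ω, x ≠ a ∧ x ≠ b → altGroup Ω := fun x hx =>
    ⟨threeCycle a b x, threeCycle_mem hab hx.2.symm⟩
  have hT : ∀ x hx, IsThreeCyclePerm (φ (T x hx) : Perm Ω) := fun x hx =>
    h3 _ ⟨a, b, x, hab, hx.1.symm, hx.2.symm, rfl⟩
  have hTinj : ∀ x y hx hy, (φ (T x hx) : Perm Ω) = φ (T y hy) → x = y := by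
    intro x y hx hy h
    have h1 : threeCycle a b x = threeCycle a b y :=
      congrArg Subtype.val (φ.injective (Subtype.ext h))
    have := DFunLike.congr_fun h1 b
    rwa [threeCycle_apply_snd hx.1.symm hx.2.symm, threeCycle_apply_snd hy.1.symm hy.2.symm]
      at this
  -- The product `(a b x)(a b y)` has order 2, which `φ` preserves; for 3-cycles this forces a
  -- common directed edge.
  have hedge : ∀ x y hx hy, x ≠ y → ∃ p, (φ (T x hx) : Perm Ω) p = (φ (T y hy) : Perm Ω) p ∧
      (φ (T x hx) : Perm Ω) p ≠ p := by
    intro x y hx hy hxy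
    obtain ⟨e1, e2⟩ :=
      threeCycle_common_edge_mul hab hx.1.symm hx.2.symm hy.1.symm hy.2.symm hxy
    refine ((hT x hx).spec (hT y hy)).2 ?_ ?_
    · have h1 : (T x hx * T y hy) ^ 2 = 1 := Subtype.ext e1
      have h2 := congrArg φ h1
      rw [map_pow, map_mul, map_one] at h2
      exact congrArg Subtype.val h2
    · intro h
      apply e2
      have h1 : φ (T x hx * T y hy) = φ 1 := by
        rw [map_mul, map_one]
        exact Subtype.ext h
      exact congrArg Subtype.val (φ.injective h1)
  -- The common edge of the images for `c` and `d` belongs to every other image too, since that one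
  -- shares an edge with both.
  have hpq : ∃ p q, p ≠ q ∧ ∀ x hx, (φ (T x hx) : Perm Ω) p = q := by
    have hc' : c ≠ a ∧ c ≠ b := hc
    have hd' : d ≠ a ∧ d ≠ b := ⟨hd.1, hd.2.1⟩
    have hcd : c ≠ d := Ne.symm hd.2.2
    obtain ⟨p, hp1, hp2⟩ := hedge c d hc' hd' hcd
    obtain ⟨q, r, hpq, hpr, hqr, hr⟩ := (hT c hc').exists_eq hp2
    obtain ⟨q', s, hpq', hps, hqs, hs⟩ := (hT d hd').exists_eq (hp1 ▸ hp2)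
    obtain rfl : q = q' := by
      rwa [hr, hs, threeCycle_apply_fst hpq hpr, threeCycle_apply_fst hpq' hps] at hp1
    have hrs : r ≠ s := by
      rintro rfl
      exact hcd (hTinj c d hc' hd' (hr.trans hs.symm))
    refine ⟨p, q, hpq, fun x hx => ?_⟩
    by_cases hxc : x = c
    · subst hxc; rw [hr, threeCycle_apply_fst hpq hpr]
    by_cases hxd : x = d
    · subst hxd; rw [hs, threeCycle_apply_fst hpq hps]
    obtain ⟨y, hy1, hy2⟩ := hedge c x hc' hx (Ne.symm hxc)
    obtain ⟨z, hz1, hz2⟩ := hedge d x hd' hx (Ne.symm hxd)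
    rw [hr] at hy1 hy2
    rw [hs] at hz1 hz2
    exact (hT x hx).apply_eq_of_common_edges hpq hpr hqr hps hqs hrs hy1 hy2 hz1 hz2
  obtain ⟨p, q, hpq, hφ⟩ := hpq
  -- The permutation sought sends `a` to `p`, `b` to `q`, and any other `x` to the third point of
  -- the image of `(a b x)`.
  let f : Ω → Ω := fun x =>
    if hx : x ≠ a ∧ x ≠ b then (φ (T x hx) : Perm Ω) q else if x = a then p else q
  have fa : f a = p := by simp [f]
  have fb : f b = q := by simp [f, hb]
  have hf : ∀ x hx, p ≠ f x ∧ q ≠ f x ∧ (φ (T x hx) : Perm Ω) = threeCycle p q (f x) := by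
    intro x hx
    have hfx : f x = (φ (T x hx) : Perm Ω) q := by simp only [f, dif_pos hx]
    obtain ⟨q', r, h1, h2, h4, h5⟩ := (hT x hx).exists_eq (p := p) (by rw [hφ x hx]; exact hpq.symm)
    have hq : q = q' := by
      have := hφ x hx
      rwa [h5, threeCycle_apply_fst h1 h2, eq_comm] at this
    subst hq
    rw [hfx, h5, threeCycle_apply_snd h2 h4]
    exact ⟨h2, h4, rfl⟩
  have finj : Function.Injective f := by
    intro x y hxy
    by_cases hx : x ≠ a ∧ x ≠ b
    · obtain ⟨x1, x2, x3⟩ := hf x hx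
      by_cases hy : y ≠ a ∧ y ≠ b
      · obtain ⟨y1, y2, y3⟩ := hf y hy
        exact hTinj x y hx hy (by rw [x3, y3, hxy])
      · have : y = a ∨ y = b := by tauto
        rcases this with rfl | rfl
        · exact absurd (hxy.trans fa).symm x1
        · exact absurd (hxy.trans fb).symm x2
    · have hx' : x = a ∨ x = b := by tauto
      by_cases hy : y ≠ a ∧ y ≠ b
      · obtain ⟨y1, y2, y3⟩ := hf y hy
        rcases hx' with rfl | rfl
        · exact absurd (fa.symm.trans hxy) y1
        · exact absurd (fb.symm.trans hxy) y2
      · have hy' : y = a ∨ y = b := by tauto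
        rcases hx' with rfl | rfl <;> rcases hy' with rfl | rfl
        · rfl
        · exact absurd (fa.symm.trans (hxy.trans fb)) hpq
        · exact absurd (fa.symm.trans (hxy.symm.trans fb)) hpq
        · rfl
  have fsurj : Function.Surjective f := by
    intro ω
    by_contra hω
    push Not at hω
    -- A point `ω` missed by `f` is fixed by the images of all generators `(a b x)`, hence by all of
    -- `Alt(Ω)`.
    let M : Subgroup (Perm Ω) := ((MulAction.stabilizer (Perm Ω) ω).comap
      ((altGroup Ω).subtype.comp φ.toMonoidHom)).map (altGroup Ω).subtype
    have hM : altGroup Ω ≤ M := by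
      refine altGroup_le_of_threeCycle_mem hab fun x hax hbx => ?_
      refine ⟨T x ⟨hax.symm, hbx.symm⟩, ?_, rfl⟩
      obtain ⟨-, -, h5⟩ := hf x ⟨hax.symm, hbx.symm⟩
      change (φ (T x ⟨hax.symm, hbx.symm⟩) : Perm Ω) ω = ω
      rw [h5]
      exact threeCycle_apply_of_ne (by rw [← fa]; exact (hω a).symm)
        (by rw [← fb]; exact (hω b).symm) (hω x).symm
    obtain ⟨g, hg, hgω⟩ := exists_threeCycle_apply_ne ω
    obtain ⟨g', hg'⟩ := φ.surjective ⟨g, hg⟩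
    obtain ⟨g'', h6, h7⟩ := hM g'.2
    have h7 : g'' = g' := Subtype.ext h7
    have h8 : (φ g'' : Perm Ω) ω = ω := h6
    rw [h7, hg'] at h8
    exact hgω h8
  let π : Perm Ω := Equiv.ofBijective f ⟨finj, fsurj⟩
  refine ⟨π, ?_⟩
  let M : Subgroup (Perm Ω) := (((altGroup Ω).subtype.comp φ.toMonoidHom).eqLocus
    ((MulAut.conj π).toMonoidHom.comp (altGroup Ω).subtype)).map (altGroup Ω).subtype
  have hM : altGroup Ω ≤ M := by
    refine altGroup_le_of_threeCycle_mem hab fun x hax hbx => ?_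
    refine ⟨T x ⟨hax.symm, hbx.symm⟩, ?_, rfl⟩
    obtain ⟨-, -, h5⟩ := hf x ⟨hax.symm, hbx.symm⟩
    change (φ (T x ⟨hax.symm, hbx.symm⟩) : Perm Ω) = π * threeCycle a b x * π⁻¹
    rw [h5, conj_threeCycle]
    change _ = threeCycle (f a) (f b) (f x)
    rw [fa, fb]
  intro g
  obtain ⟨g', h6, h7⟩ := hM g.2
  have h7 : g' = g := Subtype.ext h7
  subst h7
  exact h6

end

/-! ### Normal alternating subgroups in the tower of `H` -/

section

open Equiv

variable {Ω : Type u}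

/-- A normal copy of the alternating group yields an action of the ambient group on `Ω`. -/
theorem exists_perm_of_normal_range [Infinite Ω] {L : Type*} [Group L] {j : altGroup Ω →* L}
    (hj : Function.Injective j) (hn : j.range.Normal) (x : L) :
    ∃ π : Perm Ω, ∀ a b : altGroup Ω, (b : Perm Ω) = π * a * π⁻¹ → j b = x * j a * x⁻¹ := by
  let i : altGroup Ω ≃* j.range := MonoidHom.ofInjective hj
  let φ : MulAut (altGroup Ω) := (i.trans (MulAut.conjNormal x)).trans i.symm
  have hφ : ∀ a, j (φ a) = x * j a * x⁻¹ := by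
    intro a
    have h1 : i (φ a) = MulAut.conjNormal x (i a) := i.apply_symm_apply _
    have h2 := congrArg Subtype.val h1
    rwa [MulAut.conjNormal_apply] at h2
  obtain ⟨π, hπ⟩ := exists_conj_of_mulAut_altGroup φ
  refine ⟨π, fun a b hb => ?_⟩
  rw [← hφ]
  congr 1
  exact Subtype.ext (hb.trans (hπ a).symm)

/-- The inductive step in bounding the supports of the elements of a normal copy of the alternating
group along an ascending chain of subgroups. -/
theorem moved_subset_of_normalizes {L : Type*} [Group L] {j : altGroup Ω →* L}
    {ψ : L → Perm Ω}
    (hψ : ∀ x (a b : altGroup Ω), (b : Perm Ω) = ψ x * a * (ψ x)⁻¹ → j b = x * j a * x⁻¹)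
    {P Q : Subgroup L} (hPQ : ∀ x ∈ Q, ∀ h ∈ P, x * h * x⁻¹ ∈ P) {L₀ : Set L} (hL₀ : L₀ ⊆ P)
    {D : Set Ω} (hD : ∀ a : altGroup Ω, j a ∈ P → ∀ ω, (a : Perm Ω) ω ≠ ω → ω ∈ D)
    (hB : ∀ y : Perm Ω, {ω | y ω ≠ ω}.Finite → (∀ h ∈ L₀, Commute y (ψ h)) →
      ∀ ω, y ω ≠ ω → ω ∈ D)
    (a : altGroup Ω) (ha : j a ∈ Q) (ω : Ω) (hω : (a : Perm Ω) ω ≠ ω) : ω ∈ D := by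
  classical
  let A : Set Ω := {ω | ∃ b : altGroup Ω, j b ∈ P ∧ (b : Perm Ω) ω ≠ ω}
  have hAD : A ⊆ D := by
    rintro ω ⟨b, hb, hbω⟩
    exact hD b hb ω hbω
  have hfix : ∀ b : altGroup Ω, j b ∈ P → ∀ ω, ω ∉ A → (b : Perm Ω) ω = ω := by
    intro b hb ω hω
    by_contra h
    exact hω ⟨b, hb, h⟩
  have inv_of : ∀ g : Perm Ω, (∀ b : altGroup Ω, j b ∈ P → ∀ c : altGroup Ω,
      (c : Perm Ω) = g * b * g⁻¹ → j c ∈ P) → ∀ ω ∈ A, g ω ∈ A := by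
    rintro g hg ω ⟨b, hb, hbω⟩
    refine ⟨⟨g * b * g⁻¹, altGroup_conj_mem g b.2⟩, hg b hb _ rfl, ?_⟩
    simpa using hbω
  -- The set `A` is invariant under every permutation acting on the alternating group as an element
  -- normalizing `P` does. This applies to `ψ h` for `h ∈ P`, and to `a` itself through `j a`.
  have key : ∀ (x : L) (g : Perm Ω), (∀ b c : altGroup Ω, (c : Perm Ω) = g * b * g⁻¹ →
      j c = x * j b * x⁻¹) → (∀ h ∈ P, x * h * x⁻¹ ∈ P) → (∀ h ∈ P, x⁻¹ * h * x ∈ P) →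
      ∀ ω, g ω ∈ A ↔ ω ∈ A := by
    intro x g hg h1 h2 ω
    constructor
    · intro h
      have := inv_of g⁻¹ ?_ _ h
      · simpa using this
      · intro b hb c hc
        have h3 := hg c b (by rw [hc]; group)
        have h4 : j c = x⁻¹ * j b * x := by rw [h3]; group
        rw [h4]
        exact h2 _ hb
    · refine inv_of g ?_ ω
      intro b hb c hc
      rw [hg b c hc]
      exact h1 _ hb
  have hPinv : ∀ h ∈ P, ∀ ω, ψ h ω ∈ A ↔ ω ∈ A := fun h hh =>
    key h (ψ h) (hψ h) (fun k hk => P.mul_mem (P.mul_mem hh hk) (P.inv_mem hh))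
      (fun k hk => P.mul_mem (P.mul_mem (P.inv_mem hh) hk) hh)
  have hainv : ∀ ω, (a : Perm Ω) ω ∈ A ↔ ω ∈ A := by
    refine key (j a) a (fun b c hc => ?_) (hPQ _ ha) (fun h hh => ?_)
    · rw [← map_mul, ← map_inv, ← map_mul]
      congr 1
      exact Subtype.ext hc
    · simpa using hPQ _ (Q.inv_mem ha) h hh
  by_cases hωA : ω ∈ A
  · exact hAD hωA
  -- The part of `a` outside `A`. It is finitary but possibly odd, which is why `hB` speaks of all
  -- finitary permutations.
  let y : Perm Ω := Perm.ofSubtype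
    ((a : Perm Ω).subtypePerm (p := fun ω => ω ∉ A) fun ω => not_congr (hainv ω))
  have hyA : ∀ ω, ω ∈ A → y ω = ω := fun ω h =>
    Perm.ofSubtype_apply_of_not_mem _ (not_not.2 h)
  have hy : ∀ ω, ω ∉ A → y ω = (a : Perm Ω) ω := fun ω h =>
    Perm.ofSubtype_apply_of_mem (p := fun ω => ω ∉ A) _ h
  refine hB y ((finite_moved_of_mem_altGroup a.2).subset fun ω hω => ?_) (fun h hh => ?_) ω
    (by rwa [hy ω hωA])
  · by_cases h : ω ∈ A
    · exact absurd (hyA ω h) hω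
    · exact fun h' => hω ((hy ω h).trans h')
  · have hhP := hL₀ hh
    have hc := altGroup_conj_mem (ψ h) (inv_mem a.2)
    -- The commutator of `j a` with `h` lies in `P` by normality, so the corresponding even
    -- permutation is trivial outside `A`; there `a` commutes with `ψ h`.
    have hcP : j (a * ⟨_, hc⟩) ∈ P := by
      rw [map_mul, hψ h a⁻¹ ⟨_, hc⟩ rfl, map_inv]
      have h1 := P.mul_mem (hPQ _ ha h hhP) (P.inv_mem hhP)
      simpa only [mul_assoc] using h1
    have hcfix := hfix _ hcP
    ext ω
    rw [Perm.mul_apply, Perm.mul_apply]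
    by_cases h : ω ∈ A
    · rw [hyA ω h, hyA _ ((hPinv _ hhP ω).2 h)]
    · rw [hy ω h, hy _ (fun h' => h ((hPinv _ hhP ω).1 h'))]
      have := hcfix (ψ _ ((a : Perm Ω) ω))
        (fun h' => h ((hainv ω).1 ((hPinv _ hhP _).1 h')))
      simpa using this

/-- No stage of the automorphism tower of `H` has a normal subgroup isomorphic to the alternating
group of a set larger than `H`. -/
theorem not_normal_range_of_card_lt [Infinite Ω] (H : Type u) [Group H]
    (hH : Subgroup.center H = ⊥) (hinf : ℵ₀ ≤ #H)
    (hcard : #H < #Ω) (β : Ordinal.{u})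
    (j : altGroup Ω →* AutTowerGroup H β) (hj : Function.Injective j) : ¬ j.range.Normal := by
  intro hn
  choose ψ hψ using exists_perm_of_normal_range hj hn
  let L₀ : Set (AutTowerGroup H β) := Set.range (autTowerIncl H β)
  -- The default value `1` moves no point and so adds nothing to `A`.
  let S : H → altGroup Ω := fun h =>
    open Classical in if ha : ∃ a, j a = autTowerIncl H β h then ha.choose else 1
  have hS : ∀ h a, j a = autTowerIncl H β h → S h = a := by
    intro h a ha
    have hex : ∃ a, j a = autTowerIncl H β h := ⟨a, ha⟩
    simp only [S, dif_pos hex]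
    exact hj (hex.choose_spec.trans ha.symm)
  let A : Set Ω := ⋃ h : H, {ω | (S h : Perm Ω) ω ≠ ω}
  let C : Set (Perm Ω) := {y | {ω | y ω ≠ ω}.Finite ∧ ∀ h ∈ L₀, Commute y (ψ h)}
  let B : Set Ω := {ω | ∃ y ∈ C, y ω ≠ ω}
  have hC : ∀ y ∈ C, y ∈ altGroup Ω → y = 1 := by
    rintro y ⟨-, hy⟩ hya
    have h1 : j ⟨y, hya⟩ = 1 := by
      refine autTower_eq_one_of_commute hH fun x => ?_
      have h2 := hψ (autTowerIncl H β x) ⟨y, hya⟩ ⟨y, hya⟩ (by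
        rw [← (hy _ ⟨x, rfl⟩).eq]
        group)
      exact eq_mul_inv_iff_mul_eq.1 h2
    exact congrArg Subtype.val (hj (h1.trans j.map_one.symm))
  -- Two nontrivial elements of `C` are odd, so their product is an even element of `C`, hence
  -- trivial; they therefore move the same points.
  have hBfin : B.Finite := by
    by_cases h : ∃ y₀ ∈ C, y₀ ≠ 1
    · obtain ⟨y₀, hy₀, hne⟩ := h
      refine hy₀.1.subset ?_
      rintro ω ⟨y, hy, hyω⟩
      have hy1 : y ≠ 1 := by
        rintro rfl
        exact hyω rfl
      have h1 : y₀ * y ∈ altGroup Ω := mul_mem_altGroup_of_not_mem hy₀.1 hy.1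
        (fun h => hne (hC _ hy₀ h)) (fun h => hy1 (hC _ hy h))
      have h2 : y₀ * y = 1 := by
        refine hC _ ⟨finite_moved_of_mem_altGroup h1, fun h hh => ?_⟩ h1
        exact (hy₀.2 h hh).mul_left (hy.2 h hh)
      intro h3
      apply hyω
      have h4 := DFunLike.congr_fun h2 ω
      rw [Perm.mul_apply, Perm.one_apply] at h4
      exact y₀.injective (h4.trans h3.symm)
    · push Not at h
      convert Set.finite_empty
      rw [Set.eq_empty_iff_forall_notMem]
      rintro ω ⟨y, hy, hyω⟩
      exact hyω (by rw [h y hy, Perm.one_apply])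
  have key : ∀ (γ : Ordinal.{u}) (hγ : γ ≤ β) (a : altGroup Ω), j a ∈ (autTowerMap H hγ).range →
      ∀ ω, (a : Perm Ω) ω ≠ ω → ω ∈ A ∪ B := by
    intro γ
    induction γ using ordinal_limit_induction with
    | zero =>
      rintro hγ a ⟨x, hx⟩ ω hω
      obtain ⟨h, rfl⟩ := (autTowerIncl_zero_bijective H).2 x
      rw [autTowerMap_incl] at hx
      left
      refine Set.mem_iUnion.2 ⟨h, ?_⟩
      rw [hS h a hx.symm]
      exact hω
    | succ γ ih =>
      intro hγ
      have hγ' := (Order.le_succ γ).trans hγ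
      refine moved_subset_of_normalizes hψ (P := (autTowerMap H hγ').range) (L₀ := L₀) ?_ ?_
        (ih hγ') fun y h1 h2 ω h3 => Or.inr ⟨y, ⟨h1, h2⟩, h3⟩
      · rintro _ ⟨x, rfl⟩ _ ⟨h, rfl⟩
        obtain ⟨z, hz⟩ := autTower_conj H γ x h
        refine ⟨z, ?_⟩
        rw [← autTowerMap_trans H (Order.le_succ γ) hγ, ← hz,
          ← autTowerMap_trans H (Order.le_succ γ) hγ, map_mul, map_mul, map_inv]
      · rintro _ ⟨h, rfl⟩
        exact ⟨autTowerIncl H γ h, autTowerMap_incl H hγ' h⟩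
    | limit γ hlim ih =>
      rintro hγ a ⟨x, hx⟩
      obtain ⟨δ, hδ, z, rfl⟩ := autTower_limit H γ hlim x
      rw [autTowerMap_trans] at hx
      exact ih δ hδ _ a ⟨z, hx⟩
  have huniv : A ∪ B = Set.univ := by
    refine Set.eq_univ_of_forall fun ω => ?_
    obtain ⟨a, ha, haω⟩ := exists_threeCycle_apply_ne ω
    exact key β le_rfl ⟨a, ha⟩ ⟨_, autTowerMap_self H β _⟩ ω haω
  have hA : #A ≤ #H * ℵ₀ := by
    refine (mk_iUnion_le_sum_mk).trans ?_
    refine (Cardinal.sum_le_sum _ (fun _ => ℵ₀) fun h => ?_).trans_eq (by simp)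
    exact (Cardinal.lt_aleph0_iff_set_finite.2 (finite_moved_of_mem_altGroup (S h).2)).le
  have hBle : #B ≤ #H := (Cardinal.lt_aleph0_iff_set_finite.2 hBfin).le.trans hinf
  rw [Cardinal.mul_aleph0_eq hinf] at hA
  have hle : #Ω ≤ #H := by
    rw [← mk_univ, ← huniv]
    exact (mk_union_le A B).trans (Cardinal.add_le_of_le hinf hA hBle)
  exact absurd hcard hle.not_gt

end

/-! ### Automorphisms of a product `K × S` -/

section

open Equiv

variable {Ω : Type u} {K : Type*} [Group K] {S : Subgroup (Perm Ω)}

/-- The inclusion of the alternating group into the second factor of `K × S`. -/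
def altInr (K : Type*) [Group K] (hS : altGroup Ω ≤ S) : altGroup Ω →* K × S :=
  (MonoidHom.inr K S).comp (Subgroup.inclusion hS)

theorem altInr_injective (hS : altGroup Ω ≤ S) : Function.Injective (altInr K hS) := by
  intro a b h
  exact Subtype.ext (congrArg (fun x : K × S => (x.2 : Perm Ω)) h)

theorem altInr_conj (hS : altGroup Ω ≤ S) (z : K × S) (a c : altGroup Ω)
    (hc : (c : Perm Ω) = z.2 * a * (z.2 : Perm Ω)⁻¹) : z * altInr K hS a * z⁻¹ = altInr K hS c := by
  refine Prod.ext ?_ (Subtype.ext ?_)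
  · change z.1 * 1 * z.1⁻¹ = 1
    group
  · exact hc.symm

theorem exists_altInr_conj (hS : altGroup Ω ≤ S) (z : K × S) (a : altGroup Ω) :
    ∃ c, z * altInr K hS a * z⁻¹ = altInr K hS c :=
  ⟨⟨_, altGroup_conj_mem (z.2 : Perm Ω) a.2⟩, altInr_conj hS z a _ rfl⟩

/-- If `K` has no normal subgroup isomorphic to the alternating group, then the alternating group
is characteristic in `K × S`. -/
theorem exists_mulAut_altInr [Infinite Ω] (hS : altGroup Ω ≤ S)
    (hno : ∀ j : altGroup Ω →* K, Function.Injective j → ¬ j.range.Normal)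
    (φ : MulAut (K × S)) (a : altGroup Ω) : ∃ b, φ (altInr K hS a) = altInr K hS b := by
  set ι := altInr K hS with hι
  by_cases h : ∃ a : altGroup Ω, a ≠ 1 ∧ ∃ b, φ (ι a) = ι b
  · obtain ⟨a₀, ha₀, b₀, hb₀⟩ := h
    -- The even permutations that `φ` keeps inside the alternating group form a normal subgroup of
    -- it; by simplicity one nontrivial element suffices.
    let M : Subgroup (Perm Ω) :=
      ((ι.range.comap φ.toMonoidHom).comap ι).map (altGroup Ω).subtype
    have hM : altGroup Ω ≤ M := by
      refine altGroup_le_of_conj_mem (σ := a₀) ?_ ⟨a₀, ⟨b₀, hb₀.symm⟩, rfl⟩ a₀.2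
        (fun h => ha₀ (Subtype.ext h))
      rintro _ ⟨x, ⟨y, hy⟩, rfl⟩ g hg
      refine ⟨⟨g, hg⟩ * x * ⟨g, hg⟩⁻¹, ?_, rfl⟩
      obtain ⟨c, hc⟩ := exists_altInr_conj hS (φ (ι ⟨g, hg⟩)) y
      refine ⟨c, ?_⟩
      change ι c = φ (ι (⟨g, hg⟩ * x * ⟨g, hg⟩⁻¹))
      rw [map_mul, map_mul, map_inv, map_mul, map_mul, map_inv]
      have hy' : ι y = φ (ι x) := hy
      rw [← hy', ← hc]
    obtain ⟨x, ⟨y, hy⟩, hx⟩ := hM a.2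
    obtain rfl : x = a := Subtype.ext hx
    exact ⟨y, hy.symm⟩
  · exfalso
    have h1 : ∀ a b, φ (ι a) = ι b → a = 1 := by
      intro a b hab
      by_contra ha
      exact h ⟨a, ha, b, hab⟩
    -- The commutator lies in both normal subgroups, which meet trivially.
    have hcomm : ∀ a b, Commute (φ (ι a)) (ι b) := by
      intro a b
      obtain ⟨c, hc⟩ := exists_altInr_conj hS (φ (ι a)) b
      rw [← hι] at hc
      obtain ⟨d, hd⟩ := exists_altInr_conj hS (φ.symm (ι b)) a⁻¹
      rw [← hι] at hd
      have hd' := congrArg φ hd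
      simp only [map_mul, map_inv, MulEquiv.apply_symm_apply] at hd'
      have h2 : a * d = 1 := by
        apply h1 _ (c * b⁻¹)
        rw [map_mul, map_mul, map_mul, map_inv, ← hc, ← hd']
        simp only [mul_assoc]
      have h3 : d = a⁻¹ := (inv_eq_of_mul_eq_one_right h2).symm
      rw [h3, map_inv, map_inv] at hd'
      have h4 : ι b * (φ (ι a))⁻¹ = (φ (ι a))⁻¹ * ι b := mul_inv_eq_iff_eq_mul.1 hd'
      exact (Commute.inv_left_iff (a := φ (ι a)) (b := ι b)).1 h4.symm
    have hsnd : ∀ a, (φ (ι a)).2 = 1 := by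
      intro a
      refine Subtype.ext (eq_one_of_commute_altGroup fun b hb => ?_)
      exact congrArg (fun x : K × S => (x.2 : Perm Ω)) (hcomm a ⟨b, hb⟩).eq
    refine hno ((MonoidHom.fst K S).comp (φ.toMonoidHom.comp ι)) ?_ ⟨?_⟩
    · intro a b hab
      apply altInr_injective (K := K) hS
      apply φ.injective
      exact Prod.ext hab ((hsnd a).trans (hsnd b).symm)
    · rintro _ ⟨a, rfl⟩ x
      obtain ⟨c, hc⟩ := exists_altInr_conj hS (φ.symm (x, 1)) a
      refine ⟨c, ?_⟩
      have h2 := congrArg (fun y => (φ y).1) hc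
      simp only [map_mul, map_inv, MulEquiv.apply_symm_apply] at h2
      exact h2.symm

/-- The action of `Aut K × Sym Ω` on `K × S` for a normal subgroup `S` of `Sym Ω`. -/
def prodMulAut (K : Type*) [Group K] (S : Subgroup (Perm Ω)) [S.Normal] :
    MulAut K × Perm Ω →* MulAut (K × S) where
  toFun x := MulEquiv.prodCongr x.1 (MulAut.conjNormal x.2)
  map_one' := by
    ext x
    · rfl
    · simp [MulEquiv.prodCongr]
  map_mul' x y := by
    ext z
    · rfl
    · simp [MulEquiv.prodCongr, mul_assoc]

theorem prodMulAut_apply [S.Normal] (x : MulAut K × Perm Ω) (z : K × S) :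
    prodMulAut K S x z = (x.1 z.1, MulAut.conjNormal x.2 z.2) := rfl

theorem prodMulAut_bijective [Infinite Ω] [S.Normal] (hS : altGroup Ω ≤ S)
    (hK : Subgroup.center K = ⊥)
    (hno : ∀ j : altGroup Ω →* K, Function.Injective j → ¬ j.range.Normal) :
    Function.Bijective (prodMulAut K S) := by
  constructor
  · rw [injective_iff_map_eq_one]
    rintro ⟨α, π⟩ h
    have h1 : ∀ z : K × S, (α z.1, MulAut.conjNormal π z.2) = z := fun z =>
      DFunLike.congr_fun h z
    refine Prod.ext ?_ (eq_one_of_commute_altGroup fun a ha => ?_)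
    · ext k
      exact congrArg Prod.fst (h1 (k, 1))
    · have h2 := congrArg (fun x : K × S => (x.2 : Perm Ω)) (h1 (1, ⟨a, hS ha⟩))
      simp only [MulAut.conjNormal_apply] at h2
      exact mul_inv_eq_iff_eq_mul.1 h2
  · intro φ
    set ι := altInr K hS with hι
    choose f hf using exists_mulAut_altInr hS hno φ
    choose g hg using exists_mulAut_altInr hS hno φ.symm
    rw [← hι] at hf hg
    have hιinj : Function.Injective ι := altInr_injective hS
    let φA : MulAut (altGroup Ω) :=
      { toFun := f
        invFun := g
        left_inv := fun a => hιinj (by rw [← hg, ← hf, MulEquiv.symm_apply_apply])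
        right_inv := fun a => hιinj (by rw [← hf, ← hg, MulEquiv.apply_symm_apply])
        map_mul' := fun a b => hιinj (by rw [← hf, map_mul, map_mul, map_mul, hf, hf]) }
    obtain ⟨π, hπ⟩ := exists_conj_of_mulAut_altGroup φA
    -- The element `(k, 1)` centralizes `Alt(Ω)`, which `χ` preserves, so its image has second
    -- coordinate centralizing `Alt(Ω)`.
    have hsnd : ∀ (χ : MulAut (K × S)) (k : K), (χ (k, 1)).2 = 1 := by
      intro χ k
      refine Subtype.ext (eq_one_of_commute_altGroup fun b hb => ?_)
      obtain ⟨c, hc⟩ := exists_mulAut_altInr hS hno χ.symm ⟨b, hb⟩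
      have h1 : Commute ((k, 1) : K × S) (altInr K hS c) :=
        Prod.ext ((mul_one k).trans (one_mul k).symm) ((one_mul _).trans (mul_one _).symm)
      have h2 := h1.map χ
      rw [← hc, MulEquiv.apply_symm_apply] at h2
      exact congrArg (fun x : K × S => (x.2 : Perm Ω)) h2.eq
    -- By `hsnd` for `φ.symm`, the preimage of `K × 1` lies in `K × 1` and commutes with `(1, s)`;
    -- so the first coordinate of the image is central in `K`.
    have hfst : ∀ s : S, (φ (1, s)).1 = 1 := by
      intro s
      have : (φ (1, s)).1 ∈ Subgroup.center K := by
        rw [Subgroup.mem_center_iff]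
        intro k
        have h1 : Commute (φ.symm (k, 1)) ((1, s) : K × S) := by
          refine Prod.ext ((mul_one _).trans (one_mul _).symm) ?_
          change (φ.symm (k, 1)).2 * s = s * (φ.symm (k, 1)).2
          rw [hsnd φ.symm k, one_mul, mul_one]
        have h2 := h1.map φ
        rw [MulEquiv.apply_symm_apply] at h2
        exact congrArg Prod.fst h2.eq
      rwa [hK, Subgroup.mem_bot] at this
    have hpair : ∀ (χ : MulAut (K × S)) (k : K), χ (k, 1) = ((χ (k, 1)).1, 1) := fun χ k =>
      Prod.ext rfl (hsnd χ k)
    let α : MulAut K :=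
      { toFun := fun k => (φ (k, 1)).1
        invFun := fun k => (φ.symm (k, 1)).1
        left_inv := fun k => by
          change (φ.symm ((φ (k, 1)).1, 1)).1 = k
          rw [← hpair φ k, MulEquiv.symm_apply_apply]
        right_inv := fun k => by
          change (φ ((φ.symm (k, 1)).1, 1)).1 = k
          rw [← hpair φ.symm k, MulEquiv.apply_symm_apply]
        map_mul' := fun k l => by
          rw [← Prod.fst_mul, ← map_mul, Prod.mk_mul_mk, one_mul] }
    refine ⟨(α, π), ?_⟩
    have hs : ∀ s : S, ((φ (1, s)).2 : Perm Ω) = π * s * π⁻¹ := by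
      intro s
      set t := φ (1, s) with ht
      -- Both `t.2` and `π s π⁻¹` induce the same conjugation on `Alt(Ω)`, whose centralizer is
      -- trivial.
      have h1 : π⁻¹ * (t.2 : Perm Ω)⁻¹ * π * s = 1 := by
        refine eq_one_of_commute_altGroup fun a ha => ?_
        obtain ⟨c, hc⟩ : ∃ c : altGroup Ω, (c : Perm Ω) = s * a * (s : Perm Ω)⁻¹ :=
          ⟨⟨_, altGroup_conj_mem (s : Perm Ω) ha⟩, rfl⟩
        have h2 := altInr_conj (K := K) hS (1, s) ⟨a, ha⟩ c hc
        have h3 := congrArg φ h2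
        rw [map_mul, map_mul, map_inv, ← hι, hf, hf, ← ht] at h3
        have h4 := congrArg (fun x : K × S => (x.2 : Perm Ω)) h3
        have h5 : (t.2 : Perm Ω) * (φA ⟨a, ha⟩ : Perm Ω) * (t.2 : Perm Ω)⁻¹ = φA c := h4
        rw [hπ, hπ, hc] at h5
        rw [commute_iff_eq]
        calc _ = π⁻¹ * (t.2 : Perm Ω)⁻¹ * (π * (s * a * (s : Perm Ω)⁻¹) * π⁻¹) * π * s := by group
          _ = _ := by rw [← h5]; group
      have h6 : (t.2 : Perm Ω)⁻¹ = π * (s : Perm Ω)⁻¹ * π⁻¹ := by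
        have := congrArg (fun x => π * x * (s : Perm Ω)⁻¹ * π⁻¹) h1
        calc _ = π * (π⁻¹ * (t.2 : Perm Ω)⁻¹ * π * s) * (s : Perm Ω)⁻¹ * π⁻¹ := by group
          _ = _ := by rw [this]; group
      rw [← inv_inv (t.2 : Perm Ω), h6]
      group
    apply MulEquiv.ext
    rintro ⟨k, s⟩
    have h1 : φ (k, s) = φ (k, 1) * φ (1, s) := by
      rw [← map_mul, Prod.mk_mul_mk, mul_one, one_mul]
    rw [prodMulAut_apply, h1]
    refine Prod.ext ?_ (Subtype.ext ?_)
    · change (φ (k, 1)).1 = (φ (k, 1)).1 * (φ (1, s)).1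
      rw [hfst, mul_one]
    · change _ = (((φ (k, 1)).2 * (φ (1, s)).2 : S) : Perm Ω)
      rw [hsnd, one_mul, hs, MulAut.conjNormal_apply]

/-- If `K` has trivial centre and no normal subgroup isomorphic to the alternating group of `Ω`,
then `Aut (K × S) = Aut K × Sym Ω` for every normal subgroup `S` of `Sym Ω` that contains the
alternating group. -/
theorem exists_mulAut_prod_equiv [Infinite Ω] [S.Normal] (hS : altGroup Ω ≤ S)
    (hK : Subgroup.center K = ⊥)
    (hno : ∀ j : altGroup Ω →* K, Function.Injective j → ¬ j.range.Normal) :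
    ∃ F : MulAut (K × S) ≃* MulAut K × Perm Ω,
      ∀ z : K × S, F (MulAut.conj z) = (MulAut.conj z.1, (z.2 : Perm Ω)) := by
  let E := MulEquiv.ofBijective (prodMulAut K S) (prodMulAut_bijective hS hK hno)
  refine ⟨E.symm, fun z => ?_⟩
  rw [MulEquiv.symm_apply_eq]
  apply MulEquiv.ext
  intro w
  rfl

end

/-! ### The tower of `H × Alt(Ω)` -/

section

open Equiv

theorem center_prod_altGroup {Ω : Type u} [Infinite Ω] {H : Type u} [Group H]
    (hH : Subgroup.center H = ⊥) : Subgroup.center (H × altGroup Ω) = ⊥ := by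
  rw [eq_bot_iff]
  intro z hz
  rw [Subgroup.mem_center_iff] at hz
  rw [Subgroup.mem_bot]
  refine Prod.ext ?_ (Subtype.ext (eq_one_of_commute_altGroup fun a ha => ?_))
  · have : z.1 ∈ Subgroup.center H :=
      Subgroup.mem_center_iff.2 fun h => congrArg Prod.fst (hz (h, 1))
    rwa [hH, Subgroup.mem_bot] at this
  · exact congrArg (fun x : H × altGroup Ω => (x.2 : Perm Ω)) (hz (1, ⟨a, ha⟩)).symm

/-- `e` restricts to the inclusion `H × Alt Ω → H_β × Sym Ω`. -/
def ExtendsIncl {Ω : Type u} {H : Type u} [Group H] {β : Ordinal.{u}}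
    (e : AutTowerGroup (H × altGroup Ω) β ≃* AutTowerGroup H β × Perm Ω) : Prop :=
  ∀ (h : H) (a : altGroup Ω),
    e (autTowerIncl (H × altGroup Ω) β (h, a)) = (autTowerIncl H β h, (a : Perm Ω))

/-- The image of `H × Alt(Ω)` has trivial centralizer in `H_γ × Sym(Ω)`, so both sides are
determined by their values on `G`. Compatibility is thus automatic, and the isomorphisms may be
chosen independently at each stage. -/
theorem ExtendsIncl.compatible {Ω : Type u} [Infinite Ω] {H : Type u} [Group H]
    (hH : Subgroup.center H = ⊥) {β γ : Ordinal.{u}} (hβγ : β ≤ γ)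
    {e : AutTowerGroup (H × altGroup Ω) β ≃* AutTowerGroup H β × Perm Ω} (he : ExtendsIncl e)
    {e' : AutTowerGroup (H × altGroup Ω) γ ≃* AutTowerGroup H γ × Perm Ω} (he' : ExtendsIncl e')
    (x : AutTowerGroup (H × altGroup Ω) β) :
    e' (autTowerMap (H × altGroup Ω) hβγ x) = (autTowerMap H hβγ (e x).1, (e x).2) := by
  have h := autTower_hom_ext (H × altGroup Ω)
    (f := e'.toMonoidHom.comp (autTowerMap (H × altGroup Ω) hβγ))
    (g := ((autTowerMap H hβγ).prodMap (MonoidHom.id (Perm Ω))).comp e.toMonoidHom) ?_ ?_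
  · exact DFunLike.congr_fun h x
  · rintro ⟨h, a⟩
    change e' (autTowerMap (H × altGroup Ω) hβγ _) = (autTowerMap H hβγ (e _).1, (e _).2)
    rw [autTowerMap_incl, he', he, autTowerMap_incl]
  · intro z hz
    have hz' : ∀ (h : H) (a : altGroup Ω), Commute z (autTowerIncl H γ h, (a : Perm Ω)) := by
      intro h a
      have h1 := hz (h, a)
      rwa [← he' h a, ← autTowerMap_incl (H × altGroup Ω) hβγ]
    refine Prod.ext (autTower_eq_one_of_commute hH fun h => ?_)
      (eq_one_of_commute_altGroup fun a ha => ?_)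
    · exact congrArg Prod.fst (hz' h 1).eq
    · exact congrArg Prod.snd (hz' 1 ⟨a, ha⟩).eq

/-- The successor step: a decomposition `G_β = H_β × S` yields `G_{β + 1} = H_{β + 1} × Sym Ω`. -/
theorem exists_equiv_succ {Ω : Type u} [Infinite Ω] {H : Type u} [Group H]
    (hH : Subgroup.center H = ⊥) (hinf : ℵ₀ ≤ #H) (hcard : #H < #Ω) {β : Ordinal.{u}}
    {S : Subgroup (Perm Ω)} [S.Normal] (hS : altGroup Ω ≤ S)
    (e : AutTowerGroup (H × altGroup Ω) β ≃* AutTowerGroup H β × S)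
    (he : ∀ (h : H) (a : altGroup Ω), e (autTowerIncl (H × altGroup Ω) β (h, a)) =
      (autTowerIncl H β h, ⟨a, hS a.2⟩)) :
    ∃ e' : AutTowerGroup (H × altGroup Ω) (Order.succ β) ≃*
      AutTowerGroup H (Order.succ β) × Perm Ω, ExtendsIncl e' := by
  obtain ⟨F, hF⟩ := exists_mulAut_prod_equiv (K := AutTowerGroup H β) hS (autTower_center hH β)
    (not_normal_range_of_card_lt H hH hinf hcard β)
  obtain ⟨φ, hφ⟩ := autTower_succ (H × altGroup Ω) β
  obtain ⟨χ, hχ⟩ := autTower_succ H β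
  refine ⟨((φ.trans (MulAut.congr e)).trans F).trans
    (MulEquiv.prodCongr χ.symm (MulEquiv.refl (Perm Ω))), fun h a => ?_⟩
  rw [← autTowerMap_incl _ (Order.le_succ β), ← autTowerMap_incl H (Order.le_succ β)]
  have hconj : MulAut.congr e (MulAut.conj (autTowerIncl (H × altGroup Ω) β (h, a))) =
      MulAut.conj (e (autTowerIncl (H × altGroup Ω) β (h, a))) := by
    apply MulEquiv.ext
    intro w
    simp [MulAut.congr]
  have h1 : F (MulAut.congr e (φ (autTowerMap _ (Order.le_succ β)
      (autTowerIncl (H × altGroup Ω) β (h, a))))) =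
      (MulAut.conj (autTowerIncl H β h), (a : Perm Ω)) := by
    rw [hφ, hconj, hF, he]
  refine (congrArg (MulEquiv.prodCongr χ.symm (MulEquiv.refl (Perm Ω))) h1).trans ?_
  refine Prod.ext ?_ rfl
  change χ.symm (MulAut.conj (autTowerIncl H β h)) = _
  rw [← hχ, MulEquiv.symm_apply_apply]

/-- The limit step. -/
theorem exists_equiv_limit {Ω : Type u} [Infinite Ω] {H : Type u} [Group H]
    (hH : Subgroup.center H = ⊥) {δ : Ordinal.{u}} (hδ : Order.IsSuccLimit δ)
    (ih : ∀ β < δ, 1 ≤ β →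
      ∃ e : AutTowerGroup (H × altGroup Ω) β ≃* AutTowerGroup H β × Perm Ω, ExtendsIncl e) :
    ∃ e : AutTowerGroup (H × altGroup Ω) δ ≃* AutTowerGroup H δ × Perm Ω, ExtendsIncl e := by
  have hG := center_prod_altGroup (Ω := Ω) hH
  have h1δ : (1 : Ordinal) < δ := by
    have h0 : (0 : Ordinal) < δ := hδ.bot_lt
    simpa using hδ.succ_lt h0
  -- Representatives are moved to a stage at least `1`, because the decomposition is not available
  -- at stage `0`.
  have hrep : ∀ (X : Type u) [Group X] (x : AutTowerGroup X δ),
      ∃ (β : Ordinal.{u}) (h : β < δ) (_ : 1 ≤ β) (y : AutTowerGroup X β),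
        autTowerMap X h.le y = x := by
    intro X _ x
    obtain ⟨β, hβ, y, rfl⟩ := autTower_limit X δ hδ x
    exact ⟨max β 1, max_lt hβ h1δ, le_max_right _ _, autTowerMap X (le_max_left _ _) y,
      autTowerMap_trans X _ _ y⟩
  choose e he using ih
  let v : ∀ (β : Ordinal.{u}) (h : β < δ) (_ : 1 ≤ β), AutTowerGroup (H × altGroup Ω) β →*
      AutTowerGroup H δ × Perm Ω := fun β h h1 =>
    ((autTowerMap H h.le).prodMap (MonoidHom.id (Perm Ω))).comp (e β h h1).toMonoidHom
  have hv : ∀ β h h1 y, v β h h1 y = (autTowerMap H h.le (e β h h1 y).1, (e β h h1 y).2) :=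
    fun _ _ _ _ => rfl
  have hvmap : ∀ (β γ : Ordinal.{u}) (hβγ : β ≤ γ) (hγ : γ < δ) (h1 : 1 ≤ β) y,
      v γ hγ (h1.trans hβγ) (autTowerMap (H × altGroup Ω) hβγ y) =
        v β (hβγ.trans_lt hγ) h1 y := by
    intro β γ hβγ hγ h1 y
    rw [hv, hv, (he β (hβγ.trans_lt hγ) h1).compatible hH hβγ (he γ hγ (h1.trans hβγ)),
      autTowerMap_trans]
  have hvinj : ∀ β h h1, Function.Injective (v β h h1) := by
    intro β h h1 x y hxy
    rw [hv, hv, Prod.mk.injEq] at hxy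
    exact (e β h h1).injective (Prod.ext (autTowerMap_injective hH h.le hxy.1) hxy.2)
  choose b hb hb1 r hr using hrep (H × altGroup Ω)
  -- Defined through chosen representatives; `hF` shows independence of the choice by comparing two
  -- of them at a common later stage.
  let F : AutTowerGroup (H × altGroup Ω) δ → AutTowerGroup H δ × Perm Ω :=
    fun x => v (b x) (hb x) (hb1 x) (r x)
  have hF : ∀ (β : Ordinal.{u}) (h : β < δ) (h1 : 1 ≤ β) y,
      F (autTowerMap (H × altGroup Ω) h.le y) = v β h h1 y := by
    intro β h h1 y
    set x := autTowerMap (H × altGroup Ω) h.le y with hx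
    have hm : max (b x) β < δ := max_lt (hb x) h
    change v (b x) (hb x) (hb1 x) (r x) = _
    rw [← hvmap _ _ (le_max_left (b x) β) hm, ← hvmap _ _ (le_max_right (b x) β) hm]
    congr 1
    apply autTowerMap_injective hG hm.le
    rw [autTowerMap_trans, autTowerMap_trans, hr]
  have hFmul : ∀ x y, F (x * y) = F x * F y := by
    intro x y
    have hm : max (b x) (b y) < δ := max_lt (hb x) (hb y)
    have h1 := (hb1 x).trans (le_max_left (b x) (b y))
    have hx : x = autTowerMap _ hm.le (autTowerMap _ (le_max_left (b x) (b y)) (r x)) := by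
      rw [autTowerMap_trans, hr]
    have hy : y = autTowerMap _ hm.le (autTowerMap _ (le_max_right (b x) (b y)) (r y)) := by
      rw [autTowerMap_trans, hr]
    generalize autTowerMap _ (le_max_left (b x) (b y)) (r x) = x' at hx
    generalize autTowerMap _ (le_max_right (b x) (b y)) (r y) = y' at hy
    generalize max (b x) (b y) = m at *
    subst hx hy
    rw [← map_mul, hF _ hm h1, hF _ hm h1, hF _ hm h1, map_mul]
  let Φ : AutTowerGroup (H × altGroup Ω) δ →* AutTowerGroup H δ × Perm Ω :=
    MonoidHom.mk' F hFmul
  have hΦ : Function.Bijective Φ := by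
    constructor
    · rw [injective_iff_map_eq_one]
      intro x hx
      have h1 : v (b x) (hb x) (hb1 x) (r x) = 1 := hx
      rw [← hr x, (injective_iff_map_eq_one _).1 (hvinj _ _ _) _ h1, map_one]
    · rintro ⟨x, s⟩
      obtain ⟨β, h, h1, y, rfl⟩ := hrep H x
      refine ⟨autTowerMap _ h.le ((e β h h1).symm (y, s)), ?_⟩
      change F _ = _
      rw [hF β h h1, hv, MulEquiv.apply_symm_apply]
  refine ⟨MulEquiv.ofBijective Φ hΦ, fun h a => ?_⟩
  change F _ = _
  rw [← autTowerMap_incl _ h1δ.le, hF 1 h1δ le_rfl, hv, he 1 h1δ le_rfl, autTowerMap_incl]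

/-- The successor step is applied with `S = Alt(Ω)` at stage `0` and with `S = ⊤` afterwards; this
is how the second factor grows to `Sym(Ω)` once and then stays. -/
theorem exists_extendsIncl {Ω : Type u} [Infinite Ω] {H : Type u} [Group H]
    (hH : Subgroup.center H = ⊥) (hinf : ℵ₀ ≤ #H) (hcard : #H < #Ω) (β : Ordinal.{u})
    (hβ : 1 ≤ β) :
    ∃ e : AutTowerGroup (H × altGroup Ω) β ≃* AutTowerGroup H β × Perm Ω, ExtendsIncl e := by
  induction β using ordinal_limit_induction with
  | zero => exact absurd hβ (not_le.2 zero_lt_one)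
  | succ β ih =>
    rcases eq_or_ne β 0 with rfl | h0
    · let i := MulEquiv.ofBijective _ (autTowerIncl_zero_bijective (H × altGroup Ω))
      let k := MulEquiv.ofBijective _ (autTowerIncl_zero_bijective H)
      refine exists_equiv_succ hH hinf hcard (le_refl (altGroup Ω))
        (i.symm.trans (MulEquiv.prodCongr k (MulEquiv.refl _))) fun h a => ?_
      change MulEquiv.prodCongr k (MulEquiv.refl _) (i.symm (i (h, a))) = _
      rw [MulEquiv.symm_apply_apply]
      rfl
    · obtain ⟨e, he⟩ := ih (Order.one_le_iff_ne_zero.2 h0)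
      refine exists_equiv_succ hH hinf hcard (S := ⊤) le_top
        (e.trans (MulEquiv.prodCongr (MulEquiv.refl _) Subgroup.topEquiv.symm)) fun h a => ?_
      change MulEquiv.prodCongr (MulEquiv.refl _) Subgroup.topEquiv.symm (e _) = _
      rw [he]
      rfl
  | limit δ hδ ih => exact exists_equiv_limit hH hδ ih

/-- Lifting `(x, 1)` and reading off first coordinates works at every stage, including `0`, where
the second factor is still `Alt(Ω)`. -/
theorem autTowerStableAt_of_prod {Ω : Type u} [Infinite Ω] {H : Type u} [Group H]
    (hH : Subgroup.center H = ⊥) (hinf : ℵ₀ ≤ #H) (hcard : #H < #Ω)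
    {α : Ordinal.{u}} : AutTowerStableAt (H × altGroup Ω) α → AutTowerStableAt H α := by
  intro hG x
  obtain ⟨e', he'⟩ := exists_extendsIncl (Ω := Ω) hH hinf hcard (Order.succ α)
    (Order.one_le_iff_ne_zero.2 (bot_le.trans_lt (Order.lt_succ α)).ne')
  obtain ⟨y, hy⟩ := hG (e'.symm (x, 1))
  rw [MulEquiv.eq_symm_apply] at hy
  rcases eq_or_ne α 0 with rfl | h0
  · obtain ⟨⟨h, a⟩, rfl⟩ := (autTowerIncl_zero_bijective (H × altGroup Ω)).2 y
    rw [autTowerMap_incl, he'] at hy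
    exact ⟨autTowerIncl H 0 h, (autTowerMap_incl H _ h).trans (congrArg Prod.fst hy)⟩
  · obtain ⟨e, he⟩ := exists_extendsIncl (Ω := Ω) hH hinf hcard α
      (Order.one_le_iff_ne_zero.2 h0)
    rw [he.compatible hH (Order.le_succ α) he'] at hy
    exact ⟨(e y).1, congrArg Prod.fst hy⟩

/-- Stage `0` must be excluded: there the second factor still grows from `Alt(Ω)` to `Sym(Ω)`. The
assumption `τ(H) ≥ 1` serves to rule this stage out. -/
theorem autTowerStableAt_prod {Ω : Type u} [Infinite Ω] {H : Type u} [Group H]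
    (hH : Subgroup.center H = ⊥) (hinf : ℵ₀ ≤ #H) (hcard : #H < #Ω)
    {α : Ordinal.{u}} (hα : 1 ≤ α) (h : AutTowerStableAt H α) :
    AutTowerStableAt (H × altGroup Ω) α := by
  intro z
  obtain ⟨e, he⟩ := exists_extendsIncl (Ω := Ω) hH hinf hcard α hα
  obtain ⟨e', he'⟩ := exists_extendsIncl (Ω := Ω) hH hinf hcard (Order.succ α)
    (hα.trans (Order.le_succ α))
  obtain ⟨x, hx⟩ := h (e' z).1
  refine ⟨e.symm (x, (e' z).2), e'.injective ?_⟩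
  rw [he.compatible hH (Order.le_succ α) he', MulEquiv.apply_symm_apply, hx]

theorem one_le_of_autTowerStableAt {H : Type u} [Group H] (hτ : 1 ≤ autTowerHeight H)
    {α : Ordinal.{u}} (h : AutTowerStableAt H α) : 1 ≤ α := by
  rw [autTowerHeight, if_pos ⟨α, h⟩] at hτ
  exact (WithTop.coe_le_coe.1 hτ).trans (csInf_le' h)

end

theorem theorem4p1 {θ κ : Cardinal.{u}} (hθ : ℵ₀ ≤ θ) (hθκ : θ < κ)
    (H : Type u) [Group H] (hH : Subgroup.center H = ⊥) (hHθ : #H = θ)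
    (hτ : 1 ≤ autTowerHeight H) (Ω : Type u) (hΩ : #Ω = κ) :
    autTowerHeight (H × altGroup Ω) = autTowerHeight H ∧
    ∃ e : ∀ β : Ordinal.{u}, 1 ≤ β →
        AutTowerGroup (H × altGroup Ω) β ≃* AutTowerGroup H β × Equiv.Perm Ω,
      (∀ (β : Ordinal.{u}) (hβ : 1 ≤ β) (h : H) (a : altGroup Ω),
        e β hβ (autTowerIncl (H × altGroup Ω) β (h, a)) =
          (autTowerIncl H β h, (a : Equiv.Perm Ω))) ∧
      (∀ (β γ : Ordinal.{u}) (hβ : 1 ≤ β) (hβγ : β ≤ γ) (x : AutTowerGroup (H × altGroup Ω) β),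
        e γ (hβ.trans hβγ) (autTowerMap (H × altGroup Ω) hβγ x) =
          (autTowerMap H hβγ (e β hβ x).1, (e β hβ x).2)) := by
  subst hΩ hHθ
  have : Infinite Ω := infinite_iff.2 (hθ.trans hθκ.le)
  choose e he using exists_extendsIncl (Ω := Ω) hH hθ hθκ
  refine ⟨?_, e, he, fun β γ hβ hβγ x => (he β hβ).compatible hH hβγ (he γ _) x⟩
  -- The towers are stable at exactly the same ordinals, so the heights agree whether or not the
  -- towers terminate.
  have hst : AutTowerStableAt (H × altGroup Ω) = AutTowerStableAt H := by
    funext α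
    exact propext ⟨autTowerStableAt_of_prod hH hθ hθκ, fun h =>
      autTowerStableAt_prod hH hθ hθκ (one_le_of_autTowerStableAt hτ h) h⟩
  unfold autTowerHeight
  rw [hst]
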